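/- Let $n\ge 1$ and let $M$ be a smooth (Hausdorff, second countable) manifold of dimension $2n+1$. Let $(\phi,\xi,\eta,g)$ be an almost contact metric structure on $M$, that is, $\phi$ is a smooth $(1,1)$-tensor field, $\xi$ a smooth vector field, $\eta$ a smooth $1$-form and $g$ a smooth Riemannian metric with $$\phi^2=-I+\eta\otimes\xi,\qquad \eta(\xi)=1,\qquad g(\phi X,\phi Y)=g(X,Y)-\eta(X)\eta(Y),$$ and suppose that $\eta$ is a contact form, that is, $\eta\wedge(d\eta)^n\neq 0$ at every point of $M$. Put $D=\ker\eta$, let $\nabla$ be the Levi-Civita connection of $g$, and let $A=\nabla\xi$ be the endomorphism field $X\mapsto\nabla_X\xi$ of $TM$. Assume that $$(A\phi+\phi A)X=0\qquad\text{and}\qquad g((\nabla_X\phi)Y,Z)=0$$ for all $x\in M$ and all $X,Y,Z\in D_x$. Suppose that there are a point $p\in M$ and a real number $c$ such that every $2$-plane $\pi\subset D_p$ has sectional curvature $K_p(\pi)=c$. Then $\dim M=5$. Moreover, $A_p$ restricts to a linear isomorphism $D_p\to D_p$ if and only if $c\neq 0$. -/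

import Mathlib

open Bundle Manifold VectorField
open scoped ContDiff

noncomputable section

namespace AlmostContact

section LeviCivita

variable {E : Type*} [NormedAddCommGroup E] [NormedSpace ℝ E]
  {H : Type*} [TopologicalSpace H] {I : ModelWithCorners ℝ E H}
  {M : Type*} [TopologicalSpace M] [ChartedSpace H M] [IsManifold I ∞ M]
  (g : ContMDiffRiemannianMetric I ∞ E (fun x : M ↦ TangentSpace I x))

theorem mdifferentiableAt_metric {X Y : Π x : M, TangentSpace I x} {x : M}
    (hX : MDiffAt (T% X) x) (hY : MDiffAt (T% Y) x) :
    MDiffAt (fun y ↦ g.inner y (X y) (Y y)) x := by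
  let _ : RiemannianBundle (fun x : M ↦ TangentSpace I x) := ⟨g.toRiemannianMetric⟩
  exact MDifferentiableAt.inner_bundle (IB := I) (F := E) (E := fun x : M ↦ TangentSpace I x) hX hY

/-- The right-hand side of the Koszul formula for `2 g(∇_X Y, Z)`. -/
def koszul (X Y Z : Π x : M, TangentSpace I x) (x : M) : ℝ :=
  mvfderiv I (fun y ↦ g.inner y (Y y) (Z y)) x (X x)
    + mvfderiv I (fun y ↦ g.inner y (X y) (Z y)) x (Y x)
    - mvfderiv I (fun y ↦ g.inner y (X y) (Y y)) x (Z x)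
    + g.inner x (mlieBracket I X Y x) (Z x)
    - g.inner x (mlieBracket I X Z x) (Y x)
    - g.inner x (mlieBracket I Y Z x) (X x)

variable [FiniteDimensional ℝ E]

theorem koszul_tensorial_left {Y Z : Π x : M, TangentSpace I x} {x : M}
    (hY : MDiffAt (T% Y) x) (hZ : MDiffAt (T% Z) x) :
    TensorialAt I E (fun X ↦ koszul g X Y Z x) x where
  smul {f X} hf hX := by
    have e1 : (fun y ↦ g.inner y ((f • X) y) (Z y)) = fun y ↦ f y * g.inner y (X y) (Z y) := by
      ext y; simp
    have e2 : (fun y ↦ g.inner y ((f • X) y) (Y y)) = fun y ↦ f y * g.inner y (X y) (Y y) := by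
      ext y; simp
    simp only [koszul, e1, e2, mvfderiv_fun_mul hf (mdifferentiableAt_metric g hX hZ),
      mvfderiv_fun_mul hf (mdifferentiableAt_metric g hX hY), mlieBracket_smul_left hf hX]
    simp
    ring
  add {X X'} hX hX' := by
    have e1 : (fun y ↦ g.inner y ((X + X') y) (Z y))
        = fun y ↦ g.inner y (X y) (Z y) + g.inner y (X' y) (Z y) := by
      ext y; simp
    have e2 : (fun y ↦ g.inner y ((X + X') y) (Y y))
        = fun y ↦ g.inner y (X y) (Y y) + g.inner y (X' y) (Y y) := by
      ext y; simp
    simp only [koszul, e1, e2,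
      mvfderiv_fun_add (mdifferentiableAt_metric g hX hZ) (mdifferentiableAt_metric g hX' hZ),
      mvfderiv_fun_add (mdifferentiableAt_metric g hX hY) (mdifferentiableAt_metric g hX' hY),
      mlieBracket_add_left hX hX']
    simp
    ring

theorem koszul_tensorial_right {X Y : Π x : M, TangentSpace I x} {x : M}
    (hX : MDiffAt (T% X) x) (hY : MDiffAt (T% Y) x) :
    TensorialAt I E (fun Z ↦ koszul g X Y Z x) x where
  smul {f Z} hf hZ := by
    have e1 : (fun y ↦ g.inner y (X y) ((f • Z) y)) = fun y ↦ f y * g.inner y (X y) (Z y) := by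
      ext y; simp
    have e2 : (fun y ↦ g.inner y (Y y) ((f • Z) y)) = fun y ↦ f y * g.inner y (Y y) (Z y) := by
      ext y; simp
    simp only [koszul, e1, e2, mvfderiv_fun_mul hf (mdifferentiableAt_metric g hX hZ),
      mvfderiv_fun_mul hf (mdifferentiableAt_metric g hY hZ), mlieBracket_smul_right hf hZ]
    simp
    rw [g.symm x (Z x) (Y x), g.symm x (Z x) (X x)]
    ring
  add {Z Z'} hZ hZ' := by
    have e1 : (fun y ↦ g.inner y (X y) ((Z + Z') y))
        = fun y ↦ g.inner y (X y) (Z y) + g.inner y (X y) (Z' y) := by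
      ext y; simp
    have e2 : (fun y ↦ g.inner y (Y y) ((Z + Z') y))
        = fun y ↦ g.inner y (Y y) (Z y) + g.inner y (Y y) (Z' y) := by
      ext y; simp
    simp only [koszul, e1, e2,
      mvfderiv_fun_add (mdifferentiableAt_metric g hX hZ) (mdifferentiableAt_metric g hX hZ'),
      mvfderiv_fun_add (mdifferentiableAt_metric g hY hZ) (mdifferentiableAt_metric g hY hZ'),
      mlieBracket_add_right hZ hZ']
    simp
    ring

theorem koszul_add_mid {X Y Y' Z : Π x : M, TangentSpace I x} {x : M}
    (hX : MDiffAt (T% X) x) (hY : MDiffAt (T% Y) x) (hY' : MDiffAt (T% Y') x)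
    (hZ : MDiffAt (T% Z) x) :
    koszul g X (Y + Y') Z x = koszul g X Y Z x + koszul g X Y' Z x := by
  have e1 : (fun y ↦ g.inner y ((Y + Y') y) (Z y))
      = fun y ↦ g.inner y (Y y) (Z y) + g.inner y (Y' y) (Z y) := by
    ext y; simp
  have e2 : (fun y ↦ g.inner y (X y) ((Y + Y') y))
      = fun y ↦ g.inner y (X y) (Y y) + g.inner y (X y) (Y' y) := by
    ext y; simp
  simp only [koszul, e1, e2,
    mvfderiv_fun_add (mdifferentiableAt_metric g hY hZ) (mdifferentiableAt_metric g hY' hZ),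
    mvfderiv_fun_add (mdifferentiableAt_metric g hX hY) (mdifferentiableAt_metric g hX hY'),
    mlieBracket_add_left hY hY', mlieBracket_add_right hY hY']
  simp
  ring

theorem koszul_smul_mid {X Y Z : Π x : M, TangentSpace I x} {f : M → ℝ} {x : M}
    (hX : MDiffAt (T% X) x) (hY : MDiffAt (T% Y) x) (hZ : MDiffAt (T% Z) x)
    (hf : MDiffAt f x) :
    koszul g X (f • Y) Z x
      = f x * koszul g X Y Z x + 2 * mvfderiv I f x (X x) * g.inner x (Y x) (Z x) := by
  have e1 : (fun y ↦ g.inner y ((f • Y) y) (Z y)) = fun y ↦ f y * g.inner y (Y y) (Z y) := by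
    ext y; simp
  have e2 : (fun y ↦ g.inner y (X y) ((f • Y) y)) = fun y ↦ f y * g.inner y (X y) (Y y) := by
    ext y; simp
  simp only [koszul, e1, e2, mvfderiv_fun_mul hf (mdifferentiableAt_metric g hY hZ),
    mvfderiv_fun_mul hf (mdifferentiableAt_metric g hX hY), mlieBracket_smul_left hf hY,
    mlieBracket_smul_right hf hY]
  simp
  rw [g.symm x (Y x) (X x)]
  ring

/-- The metric at `x` as an (algebraic) isomorphism `T_x M ≃ (T_x M)^*`. -/
def flat (x : M) : TangentSpace I x ≃ₗ[ℝ] (TangentSpace I x →L[ℝ] ℝ) :=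
  haveI : FiniteDimensional ℝ (TangentSpace I x) := inferInstanceAs (FiniteDimensional ℝ E)
  haveI : T2Space (TangentSpace I x) := inferInstanceAs (T2Space E)
  LinearEquiv.ofBijective (g.inner x : TangentSpace I x →ₗ[ℝ] (TangentSpace I x →L[ℝ] ℝ)) (by
    have hinj : Function.Injective
        (g.inner x : TangentSpace I x →ₗ[ℝ] (TangentSpace I x →L[ℝ] ℝ)) := by
      rw [← LinearMap.ker_eq_bot, LinearMap.ker_eq_bot']
      intro v hv
      by_contra hne
      have h1 := g.pos x v hne
      have h2 : g.inner x v = 0 := hv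
      simp [h2] at h1
    refine ⟨hinj, ?_⟩
    have hd : Module.finrank ℝ (TangentSpace I x)
        = Module.finrank ℝ (TangentSpace I x →L[ℝ] ℝ) := by
      rw [← (LinearMap.toContinuousLinearMap (𝕜 := ℝ) (E := TangentSpace I x)
        (F' := ℝ)).finrank_eq]
      exact (Subspace.dual_finrank_eq).symm
    have : FiniteDimensional ℝ (TangentSpace I x →L[ℝ] ℝ) :=
      Module.Finite.equiv (LinearMap.toContinuousLinearMap (𝕜 := ℝ) (E := TangentSpace I x)
        (F' := ℝ))
    exact (LinearMap.injective_iff_surjective_of_finrank_eq_finrank hd).1 hinj)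

open scoped Classical in
/-- The Levi-Civita covariant derivative, as an operation: `leviCivitaFun g Y x v = (∇_v Y)_x` is
the tangent vector determined by the Koszul formula (the junk value `0` is taken if `Y` is not
differentiable at `x`). -/
def leviCivitaFun (Y : Π x : M, TangentSpace I x) (x : M) :
    TangentSpace I x →L[ℝ] TangentSpace I x :=
  haveI : FiniteDimensional ℝ (TangentSpace I x) := inferInstanceAs (FiniteDimensional ℝ E)
  haveI : T2Space (TangentSpace I x) := inferInstanceAs (T2Space E)
  if hY : MDiffAt (T% Y) x then
    LinearMap.toContinuousLinearMap
      ((1 / 2 : ℝ) • ((flat g x).symm : (TangentSpace I x →L[ℝ] ℝ) →ₗ[ℝ] TangentSpace I x) ∘ₗ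
        (TensorialAt.mkHom₂ (I := I) (F := E) (F' := E) (fun X Z ↦ koszul g X Y Z x) x
          (fun _ hZ ↦ koszul_tensorial_left g hY hZ)
          (fun _ hX ↦ koszul_tensorial_right g hX hY) :
            TangentSpace I x →ₗ[ℝ] (TangentSpace I x →L[ℝ] ℝ)))
  else 0

/-- The Koszul formula. -/
theorem two_mul_inner_leviCivitaFun {X Y Z : Π x : M, TangentSpace I x} {x : M}
    (hX : MDiffAt (T% X) x) (hY : MDiffAt (T% Y) x) (hZ : MDiffAt (T% Z) x) :
    2 * g.inner x (leviCivitaFun g Y x (X x)) (Z x) = koszul g X Y Z x := by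
  have key : ∀ l : TangentSpace I x →L[ℝ] ℝ, g.inner x ((flat g x).symm l) = l :=
    fun l ↦ (flat g x).apply_symm_apply l
  have h := TensorialAt.mkHom₂_apply (I := I) (F := E) (F' := E)
    (Φ := fun X Z ↦ koszul g X Y Z x) (x := x)
    (fun _ hZ ↦ koszul_tensorial_left g hY hZ)
    (fun _ hX ↦ koszul_tensorial_right g hX hY) hX hZ
  simp only [leviCivitaFun, hY, dif_pos]
  simp [key]
  exact h

theorem ext_inner {x : M} {v w : TangentSpace I x}
    (h : ∀ u, g.inner x v u = g.inner x w u) : v = w :=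
  (flat g x).injective (ContinuousLinearMap.ext h)

/-- The Levi-Civita connection of the Riemannian metric `g`. -/
def leviCivita : CovariantDerivative I E (fun x : M ↦ TangentSpace I x) where
  toFun := leviCivitaFun g
  isCovariantDerivativeOnUniv :=
    { add := by
        intro Y Y' x hY hY' _
        ext v
        refine ext_inner g fun u ↦ ?_
        have hv := FiberBundle.mdifferentiableAt_extend I E v
        have hu := FiberBundle.mdifferentiableAt_extend I E u
        have h1 := two_mul_inner_leviCivitaFun g hv hY hu
        have h2 := two_mul_inner_leviCivitaFun g hv hY' hu
        have h3 := two_mul_inner_leviCivitaFun g hv (mdifferentiableAt_add_section hY hY') hu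
        have h4 := koszul_add_mid g hv hY hY' hu
        simp at h1 h2 h3 ⊢
        linarith
      leibniz := by
        intro Y f x hY hf _
        ext v
        refine ext_inner g fun u ↦ ?_
        have hv := FiberBundle.mdifferentiableAt_extend I E v
        have hu := FiberBundle.mdifferentiableAt_extend I E u
        have h1 := two_mul_inner_leviCivitaFun g hv hY hu
        have h3 := two_mul_inner_leviCivitaFun g hv (hf.smul_section hY) hu
        have h4 := koszul_smul_mid g hv hY hu hf
        simp at h1 h3 h4 ⊢
        rw [← h1] at h4
        linarith }

/-- The Levi-Civita connection is torsion-free. -/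
theorem leviCivita_torsion {X Y : Π x : M, TangentSpace I x} {x : M}
    (hX : MDiffAt (T% X) x) (hY : MDiffAt (T% Y) x) :
    leviCivita g Y x (X x) - leviCivita g X x (Y x) = mlieBracket I X Y x := by
  refine ext_inner g fun u ↦ ?_
  have hu := FiberBundle.mdifferentiableAt_extend I E u
  have h1 := two_mul_inner_leviCivitaFun g hX hY hu
  have h2 := two_mul_inner_leviCivitaFun g hY hX hu
  simp only [koszul, mlieBracket_swap_apply (V := Y) (W := X), fun y ↦ g.symm y (Y y) (X y)]
    at h1 h2
  simp [leviCivita] at h1 h2 ⊢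
  linarith

/-- The Levi-Civita connection is compatible with the metric. -/
theorem leviCivita_metric {X Y Z : Π x : M, TangentSpace I x} {x : M}
    (hX : MDiffAt (T% X) x) (hY : MDiffAt (T% Y) x) (hZ : MDiffAt (T% Z) x) :
    mvfderiv I (fun y ↦ g.inner y (Y y) (Z y)) x (X x)
      = g.inner x (leviCivita g Y x (X x)) (Z x) + g.inner x (Y x) (leviCivita g Z x (X x)) := by
  have h1 := two_mul_inner_leviCivitaFun g hX hY hZ
  have h2 := two_mul_inner_leviCivitaFun g hX hZ hY
  rw [g.symm x (Y x)]
  simp only [koszul, mlieBracket_swap_apply (V := Z) (W := Y), fun y ↦ g.symm y (Z y) (Y y)]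
    at h1 h2
  simp [leviCivita] at h1 h2 ⊢
  linarith

end LeviCivita

section Tensors

variable {E : Type*} [NormedAddCommGroup E] [NormedSpace ℝ E] [FiniteDimensional ℝ E]
  {H : Type*} [TopologicalSpace H] {I : ModelWithCorners ℝ E H}
  {M : Type*} [TopologicalSpace M] [ChartedSpace H M] [IsManifold I ∞ M]

/-- The curvature tensor `R(X, Y) Z = ∇_X ∇_Y Z - ∇_Y ∇_X Z - ∇_{[X, Y]} Z` of a connection on the
tangent bundle, at the tangent vectors `u`, `v`, `w`. It is tensorial, so it may be evaluated on any
vector fields with these values at `x`; those taken here are smooth near `x`. -/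
def curvature (cov : CovariantDerivative I E (fun x : M ↦ TangentSpace I x)) (x : M)
    (u v w : TangentSpace I x) : TangentSpace I x :=
  let X : Π y : M, TangentSpace I y := FiberBundle.extend E u
  let Y : Π y : M, TangentSpace I y := FiberBundle.extend E v
  let Z : Π y : M, TangentSpace I y := FiberBundle.extend E w
  cov (fun y ↦ cov Z y (Y y)) x (X x) - cov (fun y ↦ cov Z y (X y)) x (Y x)
    - cov Z x (mlieBracket I X Y x)

/-- The sectional curvature, for the Levi-Civita connection of `g`, of the plane spanned by the
linearly independent tangent vectors `u` and `v`. -/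
def sectionalCurvature (g : ContMDiffRiemannianMetric I ∞ E (fun x : M ↦ TangentSpace I x))
    (x : M) (u v : TangentSpace I x) : ℝ :=
  g.inner x (curvature (leviCivita g) x u v v) u
    / (g.inner x u u * g.inner x v v - g.inner x u v ^ 2)

/-- The covariant derivative of an endomorphism field at the tangent vectors `u`, `v`:
`(∇_u φ) v = ∇_u (φ Y) - φ (∇_u Y)` for any vector field `Y`, differentiable at `x`, with value `v`
at `x`. -/
def nablaEndo (cov : CovariantDerivative I E (fun x : M ↦ TangentSpace I x))
    (φ : Π x : M, TangentSpace I x →L[ℝ] TangentSpace I x) (x : M) (u v : TangentSpace I x) :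
    TangentSpace I x :=
  let Y : Π y : M, TangentSpace I y := FiberBundle.extend E v
  cov (fun y ↦ φ y (Y y)) x u - φ x (cov Y x u)

/-- The exterior derivative of a `1`-form at the tangent vectors `u`, `v`, with the convention
`2 dη(X, Y) = X (η Y) - Y (η X) - η [X, Y]`. -/
def extDerivOneForm (η : Π x : M, TangentSpace I x →L[ℝ] ℝ) (x : M) (u v : TangentSpace I x) : ℝ :=
  let X : Π y : M, TangentSpace I y := FiberBundle.extend E u
  let Y : Π y : M, TangentSpace I y := FiberBundle.extend E v
  (1 / 2) * (mvfderiv I (fun y ↦ η y (Y y)) x (X x) - mvfderiv I (fun y ↦ η y (X y)) x (Y x)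
    - η x (mlieBracket I X Y x))

/-- The `(2 n + 1)`-form `η ∧ (dη)^n`, evaluated on tangent vectors `v 0, …, v (2 n)`: the
alternation of `η ⊗ dη ⊗ ⋯ ⊗ dη`. -/
def wedgePow (n : ℕ) (η : Π x : M, TangentSpace I x →L[ℝ] ℝ) (x : M)
    (v : Fin (2 * n + 1) → TangentSpace I x) : ℝ :=
  (1 / (Nat.factorial (2 * n + 1) : ℝ)) *
    ∑ σ : Equiv.Perm (Fin (2 * n + 1)), ((Equiv.Perm.sign σ : ℤ) : ℝ) *
      (η x (v (σ 0)) * ∏ i : Fin n, extDerivOneForm η x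
        (v (σ ⟨2 * (i : ℕ) + 1, by omega⟩)) (v (σ ⟨2 * (i : ℕ) + 2, by omega⟩)))

/-- A `1`-form `η` on a `(2 n + 1)`-dimensional manifold is a contact form if `η ∧ (dη)^n` vanishes
nowhere. -/
def IsContactForm (n : ℕ) (η : Π x : M, TangentSpace I x →L[ℝ] ℝ) : Prop :=
  ∀ x : M, ∃ v : Fin (2 * n + 1) → TangentSpace I x, wedgePow n η x v ≠ 0

end Tensors

/-- An almost contact metric structure `(φ, ξ, η, g)` on a smooth manifold: smooth tensor fields
with `φ² = -I + η ⊗ ξ`, `η(ξ) = 1` and `g(φ X, φ Y) = g(X, Y) - η(X) η(Y)`. -/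
structure AlmostContactMetricStructure {E : Type*} [NormedAddCommGroup E] [NormedSpace ℝ E]
    {H : Type*} [TopologicalSpace H] (I : ModelWithCorners ℝ E H)
    (M : Type*) [TopologicalSpace M] [ChartedSpace H M] [IsManifold I ∞ M] where
  φ : Π x : M, TangentSpace I x →L[ℝ] TangentSpace I x
  ξ : Π x : M, TangentSpace I x
  η : Π x : M, TangentSpace I x →L[ℝ] ℝ
  g : ContMDiffRiemannianMetric I ∞ E (fun x : M ↦ TangentSpace I x)
  contMDiff_φ : ContMDiff I (I.prod 𝓘(ℝ, E →L[ℝ] E)) ∞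
    (fun x ↦ TotalSpace.mk' (E →L[ℝ] E)
      (E := fun y : M ↦ TangentSpace I y →L[ℝ] TangentSpace I y) x (φ x))
  contMDiff_ξ : ContMDiff I (I.prod 𝓘(ℝ, E)) ∞
    (fun x ↦ TotalSpace.mk' E (E := fun y : M ↦ TangentSpace I y) x (ξ x))
  contMDiff_η : ContMDiff I (I.prod 𝓘(ℝ, E →L[ℝ] ℝ)) ∞
    (fun x ↦ TotalSpace.mk' (E →L[ℝ] ℝ) (E := fun y : M ↦ TangentSpace I y →L[ℝ] ℝ) x (η x))
  φ_φ : ∀ (x : M) (v : TangentSpace I x), φ x (φ x v) = -v + η x v • ξ x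
  η_ξ : ∀ x : M, η x (ξ x) = 1
  inner_φ_φ : ∀ (x : M) (u v : TangentSpace I x),
    g.inner x (φ x u) (φ x v) = g.inner x u v - η x u * η x v

namespace AlmostContactMetricStructure

variable {E : Type*} [NormedAddCommGroup E] [NormedSpace ℝ E]
  {H : Type*} [TopologicalSpace H] {I : ModelWithCorners ℝ E H}
  {M : Type*} [TopologicalSpace M] [ChartedSpace H M] [IsManifold I ∞ M]

/-- The fibre `D_x = ker η_x` of the horizontal distribution. -/
def D (S : AlmostContactMetricStructure I M) (x : M) : Submodule ℝ (TangentSpace I x) :=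
  LinearMap.ker (S.η x : TangentSpace I x →ₗ[ℝ] ℝ)

/-- The endomorphism field `A = ∇ξ : v ↦ ∇_v ξ`, for the Levi-Civita connection of `g`. -/
def A [FiniteDimensional ℝ E] (S : AlmostContactMetricStructure I M) (x : M) :
    TangentSpace I x →L[ℝ] TangentSpace I x :=
  leviCivita S.g S.ξ x

end AlmostContactMetricStructure

end AlmostContact

end

noncomputable section

namespace AlmostContact

section Smoothness
variable {E : Type*} [NormedAddCommGroup E] [NormedSpace ℝ E]
  {H : Type*} [TopologicalSpace H] {I : ModelWithCorners ℝ E H}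
  {M : Type*} [TopologicalSpace M] [ChartedSpace H M] [IsManifold I ∞ M]
  (g : ContMDiffRiemannianMetric I ∞ E (fun x : M ↦ TangentSpace I x))
  {X Y Z W : Π x : M, TangentSpace I x} {f : M → ℝ} {x : M}

theorem contMDiffAt_inner (hX : CMDiffAt ∞ (T% X) x) (hY : CMDiffAt ∞ (T% Y) x) :
    CMDiffAt ∞ (fun y ↦ g.inner y (X y) (Y y)) x := by
  let _ : RiemannianBundle (fun x : M ↦ TangentSpace I x) := ⟨g.toRiemannianMetric⟩
  exact ContMDiffAt.inner_bundle (IB := I) (F := E) (E := fun x : M ↦ TangentSpace I x) hX hY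

theorem contMDiffAt_mlieBracket [CompleteSpace E]
    (hX : CMDiffAt ∞ (T% X) x) (hY : CMDiffAt ∞ (T% Y) x) :
    CMDiffAt ∞ (T% (mlieBracket I X Y)) x := by
  have : IsManifold I ((⊤ : ℕ∞) + 1) M := ‹IsManifold I ∞ M›
  have : IsManifold I (minSmoothness ℝ 2) M := by
    rw [minSmoothness_of_isRCLikeNormedField]; infer_instance
  refine ContMDiffAt.mlieBracket_vectorField (m := ⊤) (n := ⊤) hX hY ?_
  rw [minSmoothness_of_isRCLikeNormedField]
  rfl

theorem eventually_mdifferentiableAt_section (hX : CMDiffAt ∞ (T% X) x) :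
    ∀ᶠ y in nhds x, MDiffAt (T% X) y := by
  have h := (contMDiffAt_iff_contMDiffAt_nhds (n := 1) (by simp)).1
    (hX.of_le (m := 1) (mod_cast le_top))
  filter_upwards [h] with y hy using hy.mdifferentiableAt (by simp)

theorem eventually_mdifferentiableAt_fun (hf : CMDiffAt ∞ f x) :
    ∀ᶠ y in nhds x, MDiffAt f y := by
  have h := (contMDiffAt_iff_contMDiffAt_nhds (n := 1) (by simp)).1
    (hf.of_le (m := 1) (mod_cast le_top))
  filter_upwards [h] with y hy using hy.mdifferentiableAt (by simp)

omit [IsManifold I ∞ M] in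
theorem mvfderiv_congr {f f' : M → ℝ} (h : f =ᶠ[nhds x] f') : mvfderiv I f x = mvfderiv I f' x := by
  simp only [mvfderiv, h.mfderiv_eq]
  rfl

open Module in
theorem contMDiffAt_mvfderiv_apply [FiniteDimensional ℝ E] [Nontrivial E]
    (hf : CMDiffAt ∞ f x) (hY : CMDiffAt ∞ (T% Y) x) :
    CMDiffAt ∞ (fun y ↦ mvfderiv I f y (Y y)) x := by
  let e := trivializationAt E (fun y : M ↦ TangentSpace I y) x
  have hx : x ∈ e.baseSet := FiberBundle.mem_baseSet_trivializationAt' x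
  let b := finBasis ℝ E
  let i : Fin (finrank ℝ E) := ⟨0, finrank_pos⟩
  have hW : CMDiffAt ∞ (T% (e.localFrame b i)) x := contMDiffAt_localFrame_of_mem ∞ e b i hx
  have h1 := (contMDiffAt_mlieBracket hY (hf.smul_section hW)).sub_section
    (hf.smul_section (contMDiffAt_mlieBracket hY hW))
  refine (contMDiffAt_localFrameCoeff b hx h1 i).congr_of_eventuallyEq ?_
  filter_upwards [e.open_baseSet.mem_nhds hx, eventually_mdifferentiableAt_fun hf,
    eventually_mdifferentiableAt_section hW] with y hy hfy hWy
  have h2 : e.localFrameCoeff I b i y (e.localFrame b i y) = 1 := by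
    rw [e.localFrameCoeff_apply_of_mem_baseSet b hy (e.localFrame b i) i]
    simp [hy]
  simp [mlieBracket_smul_right hfy hWy, h2, -Bundle.Trivialization.localFrame_apply_of_mem_baseSet]

theorem mvfderiv_mlieBracket [FiniteDimensional ℝ E] [Nontrivial E]
    (hf : CMDiffAt ∞ f x) (hX : CMDiffAt ∞ (T% X) x) (hY : CMDiffAt ∞ (T% Y) x) :
    mvfderiv I f x (mlieBracket I X Y x) = mvfderiv I (fun y ↦ mvfderiv I f y (Y y)) x (X x)
      - mvfderiv I (fun y ↦ mvfderiv I f y (X y)) x (Y x) := by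
  have : IsManifold I (minSmoothness ℝ 3) M := by
    rw [minSmoothness_of_isRCLikeNormedField]; infer_instance
  have h2 : minSmoothness ℝ 2 ≤ ∞ := by
    rw [minSmoothness_of_isRCLikeNormedField]; exact ENat.LEInfty.out
  obtain ⟨w, hw⟩ : ∃ w : TangentSpace I x, w ≠ 0 := exists_ne (0 : E)
  let W : Π y : M, TangentSpace I y := FiberBundle.extend E w
  have hWx : W x ≠ 0 := by simpa [W] using hw
  have hW : CMDiffAt ∞ (T% W) x := FiberBundle.contMDiffAt_extend I E _
  have expand : ∀ {U V : Π y : M, TangentSpace I y}, CMDiffAt ∞ (T% U) x → CMDiffAt ∞ (T% V) x →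
      mlieBracket I U (mlieBracket I V (f • W)) x
        = mvfderiv I (fun y ↦ mvfderiv I f y (V y)) x (U x) • W x
          + mvfderiv I f x (V x) • mlieBracket I U W x
          + mvfderiv I f x (U x) • mlieBracket I V W x
          + f x • mlieBracket I U (mlieBracket I V W) x := by
    intro U V hU hV
    have hVf := contMDiffAt_mvfderiv_apply hf hV
    have hVW := contMDiffAt_mlieBracket hV hW
    have h1 : mlieBracket I V (f • W) =ᶠ[nhds x]
        (fun y ↦ mvfderiv I f y (V y)) • W + f • mlieBracket I V W := by
      filter_upwards [eventually_mdifferentiableAt_fun hf,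
        eventually_mdifferentiableAt_section hW] with y hfy hWy
      exact mlieBracket_smul_right hfy hWy
    rw [Filter.EventuallyEq.rfl.mlieBracket_vectorField_eq h1,
      mlieBracket_add_right ((hVf.smul_section hW).mdifferentiableAt (by simp))
        ((hf.smul_section hVW).mdifferentiableAt (by simp)),
      mlieBracket_smul_right (hVf.mdifferentiableAt (by simp)) (hW.mdifferentiableAt (by simp)),
      mlieBracket_smul_right (hf.mdifferentiableAt (by simp)) (hVW.mdifferentiableAt (by simp))]
    abel
  have jac := leibniz_identity_mlieBracket_apply (hX.of_le h2) (hY.of_le h2)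
    ((hf.smul_section hW).of_le h2)
  have jacW := leibniz_identity_mlieBracket_apply (hX.of_le h2) (hY.of_le h2) (hW.of_le h2)
  rw [expand hX hY, expand hY hX, mlieBracket_smul_right (hf.mdifferentiableAt (by simp))
    (hW.mdifferentiableAt (by simp)), jacW] at jac
  have h0 : (mvfderiv I f x (mlieBracket I X Y x)
      - (mvfderiv I (fun y ↦ mvfderiv I f y (Y y)) x (X x)
      - mvfderiv I (fun y ↦ mvfderiv I f y (X y)) x (Y x))) • W x = 0 := by
    linear_combination (norm := module) -jac
  exact sub_eq_zero.1 ((smul_eq_zero.1 h0).resolve_right hWx)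

omit [IsManifold I ∞ M] in
theorem contMDiffAt_det {ι : Type*} [Fintype ι] [DecidableEq ι] {A : M → Matrix ι ι ℝ}
    (hA : ∀ i j, CMDiffAt ∞ (fun y ↦ A y i j) x) : CMDiffAt ∞ (fun y ↦ (A y).det) x := by
  simp only [Matrix.det_apply']
  exact contMDiffAt_finsetSum fun σ _ ↦
    contMDiffAt_const.mul (contMDiffAt_finsetProd fun i _ ↦ hA (σ i) i)

open Module in
/-- A vector field is smooth at a point if its inner products with smooth fields are. -/
theorem contMDiffAt_of_inner [FiniteDimensional ℝ E]
    (h : ∀ U : Π y : M, TangentSpace I y, CMDiffAt ∞ (T% U) x →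
      CMDiffAt ∞ (fun y ↦ g.inner y (X y) (U y)) x) :
    CMDiffAt ∞ (T% X) x := by
  let e := trivializationAt E (fun y : M ↦ TangentSpace I y) x
  have hx : x ∈ e.baseSet := FiberBundle.mem_baseSet_trivializationAt' x
  let b := finBasis ℝ E
  have hU (i) : CMDiffAt ∞ (T% (e.localFrame b i)) x := contMDiffAt_localFrame_of_mem ∞ e b i hx
  let G : M → Matrix (Fin (finrank ℝ E)) (Fin (finrank ℝ E)) ℝ :=
    fun y ↦ .of fun i j ↦ g.inner y (e.localFrame b j y) (e.localFrame b i y)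
  let β : M → Fin (finrank ℝ E) → ℝ := fun y i ↦ g.inner y (X y) (e.localFrame b i y)
  let γ : M → Fin (finrank ℝ E) → ℝ := fun y i ↦ e.localFrameCoeff I b i y (X y)
  have hGβ : ∀ y ∈ e.baseSet, (G y).mulVec (γ y) = β y := by
    intro y hy
    ext i
    have key := congrArg (fun v ↦ g.inner y v (e.localFrame b i y))
      (e.eq_sum_localFrameCoeff_smul (I := I) (b := b) (s := X) hy)
    simp only [map_sum, map_smul, sum_apply, smul_apply,
      smul_eq_mul] at key
    simp only [Matrix.mulVec, dotProduct, G, γ, β, Matrix.of_apply, key, mul_comm]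
  have hG : CMDiffAt ∞ (fun y ↦ (G y).det) x :=
    contMDiffAt_det fun i j ↦ contMDiffAt_inner g (hU j) (hU i)
  have hdet : (G x).det ≠ 0 := by
    intro h0
    obtain ⟨v, hv, hGv⟩ := Matrix.exists_mulVec_eq_zero_iff.2 h0
    let U : TangentSpace I x := ∑ j, v j • e.localFrame b j x
    have hUE (i) : g.inner x U (e.localFrame b i x) = 0 := by
      have := congrFun hGv i
      simp only [Matrix.mulVec, dotProduct, G, Matrix.of_apply, Pi.zero_apply] at this
      simp only [U, map_sum, map_smul, sum_apply,
        smul_apply, smul_eq_mul]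
      simpa only [mul_comm] using this
    have hUU : g.inner x U U = 0 := by
      conv_lhs => arg 2; simp only [U]
      simp only [map_sum, map_smul, hUE, smul_zero, Finset.sum_const_zero]
    have hU0 : U = 0 := by
      by_contra hne
      exact (g.pos x U hne).ne' hUU
    refine hv (funext fun i ↦ ?_)
    simp only [U, e.localFrame_apply_of_mem_baseSet b hx] at hU0
    exact Fintype.linearIndependent_iff.1 (e.basisAt b hx).linearIndependent v hU0 i
  rw [contMDiffAt_iff_localFrameCoeff b hx]
  intro i
  have hc : CMDiffAt ∞ (fun y ↦ ((G y).updateCol i (β y)).det) x := by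
    refine contMDiffAt_det fun j k ↦ ?_
    by_cases hk : k = i
    · simpa [Matrix.updateCol_apply, hk] using h _ (hU j)
    · simpa [Matrix.updateCol_apply, hk] using! contMDiffAt_inner g (hU k) (hU j)
  refine (hc.div₀ hG hdet).congr_of_eventuallyEq ?_
  filter_upwards [e.open_baseSet.mem_nhds hx, hG.continuousAt.eventually_ne hdet] with y hy hy'
  change γ y i = ((G y).updateCol i (β y)).det / (G y).det
  rw [eq_div_iff hy', ← Matrix.cramer_apply, ← hGβ y hy, Matrix.cramer_eq_adjugate_mulVec,
    Matrix.mulVec_mulVec, Matrix.adjugate_mul]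
  simp [γ, mul_comm, Matrix.smul_mulVec]
end Smoothness

section Curvature
variable {E : Type*} [NormedAddCommGroup E] [NormedSpace ℝ E] [FiniteDimensional ℝ E]
  {H : Type*} [TopologicalSpace H] {I : ModelWithCorners ℝ E H}
  {M : Type*} [TopologicalSpace M] [ChartedSpace H M] [IsManifold I ∞ M]
  (g : ContMDiffRiemannianMetric I ∞ E (fun x : M ↦ TangentSpace I x))
  {X Y Z W : Π x : M, TangentSpace I x} {f : M → ℝ} {x : M}

theorem contMDiffAt_leviCivita [Nontrivial E]
    (hX : CMDiffAt ∞ (T% X) x) (hY : CMDiffAt ∞ (T% Y) x) :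
    CMDiffAt ∞ (T% (fun y ↦ leviCivita g Y y (X y))) x := by
  refine contMDiffAt_of_inner g fun U hU ↦ ?_
  have h : CMDiffAt ∞ (fun y ↦ (1 / 2 : ℝ) * koszul g X Y U y) x := by
    refine contMDiffAt_const.mul ?_
    exact (((((contMDiffAt_mvfderiv_apply (contMDiffAt_inner g hY hU) hX).add
      (contMDiffAt_mvfderiv_apply (contMDiffAt_inner g hX hU) hY)).sub
      (contMDiffAt_mvfderiv_apply (contMDiffAt_inner g hX hY) hU)).add
      (contMDiffAt_inner g (contMDiffAt_mlieBracket hX hY) hU)).sub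
      (contMDiffAt_inner g (contMDiffAt_mlieBracket hX hU) hY)).sub
      (contMDiffAt_inner g (contMDiffAt_mlieBracket hY hU) hX)
  refine h.congr_of_eventuallyEq ?_
  filter_upwards [eventually_mdifferentiableAt_section hX, eventually_mdifferentiableAt_section hY,
    eventually_mdifferentiableAt_section hU] with y hXy hYy hUy
  rw [← two_mul_inner_leviCivitaFun g hXy hYy hUy]
  simp [leviCivita]

theorem leviCivita_congr (hX : MDiffAt (T% X) x) (hY : MDiffAt (T% Y) x)
    (h : ∀ᶠ y in nhds x, X y = Y y) : leviCivita g X x = leviCivita g Y x :=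
  (leviCivita g).isCovariantDerivativeOnUniv.congr_of_eventuallyEq hX hY Filter.univ_mem h

theorem leviCivita_sub (hX : MDiffAt (T% X) x) (hY : MDiffAt (T% Y) x) :
    leviCivita g (X - Y) x = leviCivita g X x - leviCivita g Y x := by
  have h := (leviCivita g).isCovariantDerivativeOnUniv.add (mdifferentiableAt_sub_section hX hY) hY
  rw [sub_add_cancel] at h
  exact eq_sub_of_add_eq h.symm

/-- The curvature operator on vector fields. -/
def curvatureField (X Y Z : Π x : M, TangentSpace I x) (x : M) : TangentSpace I x :=
  leviCivita g (fun y ↦ leviCivita g Z y (Y y)) x (X x)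
    - leviCivita g (fun y ↦ leviCivita g Z y (X y)) x (Y x)
    - leviCivita g Z x (mlieBracket I X Y x)

theorem curvature_eq_curvatureField (u v w : TangentSpace I x) :
    curvature (leviCivita g) x u v w = curvatureField g (FiberBundle.extend E u)
      (FiberBundle.extend E v) (FiberBundle.extend E w) x := rfl

theorem curvatureField_swap :
    curvatureField g Y X Z x = -curvatureField g X Y Z x := by
  simp only [curvatureField]
  rw [mlieBracket_swap_apply (V := Y) (W := X), map_neg]
  abel

variable [Nontrivial E]

/-- The first Bianchi identity. -/
theorem curvatureField_bianchi (hX : CMDiffAt ∞ (T% X) x) (hY : CMDiffAt ∞ (T% Y) x)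
    (hZ : CMDiffAt ∞ (T% Z) x) :
    curvatureField g X Y Z x + curvatureField g Y Z X x + curvatureField g Z X Y x = 0 := by
  have : IsManifold I (minSmoothness ℝ 3) M := by
    rw [minSmoothness_of_isRCLikeNormedField]; infer_instance
  have h2 : minSmoothness ℝ 2 ≤ ∞ := by
    rw [minSmoothness_of_isRCLikeNormedField]; exact ENat.LEInfty.out
  have jac := leibniz_identity_mlieBracket_apply (hX.of_le h2) (hY.of_le h2) (hZ.of_le h2)
  have key : ∀ {U V : Π y : M, TangentSpace I y}, CMDiffAt ∞ (T% U) x → CMDiffAt ∞ (T% V) x →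
      ∀ u : TangentSpace I x, leviCivita g (mlieBracket I U V) x u
        = leviCivita g (fun y ↦ leviCivita g V y (U y)) x u
          - leviCivita g (fun y ↦ leviCivita g U y (V y)) x u := by
    intro U V hU hV u
    have hUV := (contMDiffAt_leviCivita g hU hV).mdifferentiableAt (by simp)
    have hVU := (contMDiffAt_leviCivita g hV hU).mdifferentiableAt (by simp)
    have h : ∀ᶠ y in nhds x, mlieBracket I U V y
        = ((fun y ↦ leviCivita g V y (U y)) - (fun y ↦ leviCivita g U y (V y))) y := by
      filter_upwards [eventually_mdifferentiableAt_section hU,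
        eventually_mdifferentiableAt_section hV] with y hUy hVy
      exact (leviCivita_torsion g hUy hVy).symm
    rw [leviCivita_congr g ((contMDiffAt_mlieBracket hU hV).mdifferentiableAt (by simp))
      (mdifferentiableAt_sub_section hUV hVU) h, leviCivita_sub g hUV hVU]
    rfl
  have tor : ∀ {U V : Π y : M, TangentSpace I y}, CMDiffAt ∞ (T% U) x → CMDiffAt ∞ (T% V) x →
      leviCivita g U x (V x) = leviCivita g V x (U x) - mlieBracket I U V x := by
    intro U V hU hV
    rw [← leviCivita_torsion g (hU.mdifferentiableAt (by simp)) (hV.mdifferentiableAt (by simp))]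
    abel
  have hXY := contMDiffAt_mlieBracket hX hY
  have hYZ := contMDiffAt_mlieBracket hY hZ
  have hZX := contMDiffAt_mlieBracket hZ hX
  simp only [curvatureField]
  rw [tor hZ hXY, tor hX hYZ, tor hY hZX, key hX hY, key hY hZ, key hZ hX]
  have hneg : mlieBracket I Y (mlieBracket I X Z) x = -mlieBracket I Y (mlieBracket I Z X) x := by
    rw [mlieBracket_swap (V := X) (W := Z), ← neg_one_smul ℝ (mlieBracket I Z X),
      mlieBracket_const_smul_right (hZX.mdifferentiableAt (by simp)), neg_one_smul]
  rw [mlieBracket_swap_apply (V := mlieBracket I X Y) (W := Z), hneg] at jac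
  rw [jac]
  abel

/-- The curvature operator is skew-adjoint. -/
theorem inner_curvatureField_skew (hX : CMDiffAt ∞ (T% X) x) (hY : CMDiffAt ∞ (T% Y) x)
    (hZ : CMDiffAt ∞ (T% Z) x) (hW : CMDiffAt ∞ (T% W) x) :
    g.inner x (curvatureField g X Y Z x) (W x) = -g.inner x (curvatureField g X Y W x) (Z x) := by
  have key : ∀ {U V : Π y : M, TangentSpace I y}, CMDiffAt ∞ (T% U) x → CMDiffAt ∞ (T% V) x →
      mvfderiv I (fun y ↦ mvfderiv I (fun z ↦ g.inner z (Z z) (W z)) y (V y)) x (U x)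
        = g.inner x (leviCivita g (fun y ↦ leviCivita g Z y (V y)) x (U x)) (W x)
          + g.inner x (leviCivita g Z x (V x)) (leviCivita g W x (U x))
          + g.inner x (leviCivita g Z x (U x)) (leviCivita g W x (V x))
          + g.inner x (Z x) (leviCivita g (fun y ↦ leviCivita g W y (V y)) x (U x)) := by
    intro U V hU hV
    have hVZ := contMDiffAt_leviCivita g hV hZ
    have hVW := contMDiffAt_leviCivita g hV hW
    have h : (fun y ↦ mvfderiv I (fun z ↦ g.inner z (Z z) (W z)) y (V y)) =ᶠ[nhds x]
        fun y ↦ g.inner y (leviCivita g Z y (V y)) (W y)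
          + g.inner y (Z y) (leviCivita g W y (V y)) := by
      filter_upwards [eventually_mdifferentiableAt_section hV,
        eventually_mdifferentiableAt_section hZ,
        eventually_mdifferentiableAt_section hW] with y hVy hZy hWy
      exact leviCivita_metric g hVy hZy hWy
    have hU' := hU.mdifferentiableAt (n := ∞) (by simp)
    have hZ' := hZ.mdifferentiableAt (n := ∞) (by simp)
    have hW' := hW.mdifferentiableAt (n := ∞) (by simp)
    have hVZ' := hVZ.mdifferentiableAt (n := ∞) (by simp)
    have hVW' := hVW.mdifferentiableAt (n := ∞) (by simp)
    rw [mvfderiv_congr h, mvfderiv_fun_add (mdifferentiableAt_metric g hVZ' hW')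
      (mdifferentiableAt_metric g hZ' hVW'), add_apply,
      leviCivita_metric g hU' hVZ' hW', leviCivita_metric g hU' hZ' hVW']
    ring
  have hb := mvfderiv_mlieBracket (contMDiffAt_inner g hZ hW) hX hY
  rw [key hX hY, key hY hX, leviCivita_metric g ((contMDiffAt_mlieBracket hX hY).mdifferentiableAt
    (by simp)) (hZ.mdifferentiableAt (by simp)) (hW.mdifferentiableAt (by simp))] at hb
  rw [g.symm x (curvatureField g X Y W x)]
  simp only [curvatureField, map_sub, sub_apply]
  linarith

theorem inner_curvatureField_pair_symm (hX : CMDiffAt ∞ (T% X) x) (hY : CMDiffAt ∞ (T% Y) x)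
    (hZ : CMDiffAt ∞ (T% Z) x) (hW : CMDiffAt ∞ (T% W) x) :
    g.inner x (curvatureField g X Y Z x) (W x) = g.inner x (curvatureField g Z W X x) (Y x) := by
  have b1 := congrArg (fun v ↦ g.inner x v (W x)) (curvatureField_bianchi g hX hY hZ)
  have b2 := congrArg (fun v ↦ g.inner x v (X x)) (curvatureField_bianchi g hY hZ hW)
  have b3 := congrArg (fun v ↦ g.inner x v (Y x)) (curvatureField_bianchi g hZ hW hX)
  have b4 := congrArg (fun v ↦ g.inner x v (Z x)) (curvatureField_bianchi g hW hX hY)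
  simp only [map_add, add_apply, map_zero, zero_apply]
    at b1 b2 b3 b4
  have sw : ∀ U V T : Π y : M, TangentSpace I y, ∀ u, g.inner x (curvatureField g U V T x) u
      = -g.inner x (curvatureField g V U T x) u := by
    intro U V T u; rw [curvatureField_swap]; simp
  have e1 := inner_curvatureField_skew g hX hY hZ hW
  have e2 := inner_curvatureField_skew g hX hZ hY hW
  have e3 := inner_curvatureField_skew g hX hW hY hZ
  have e4 := inner_curvatureField_skew g hY hZ hX hW
  have e5 := inner_curvatureField_skew g hY hW hX hZ
  have e6 := inner_curvatureField_skew g hZ hW hX hY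
  have s2 := fun T u ↦ sw Z X T u
  have s3 := fun T u ↦ sw W X T u
  have s5 := fun T u ↦ sw W Y T u
  simp only [s2, s3, s5] at b1 b2 b3 b4
  linarith

/-- The curvature `g(R(X, Y) Z, W)` depends only on the values of the fields at the point. -/
theorem inner_curvatureField_eq (hX : CMDiffAt ∞ (T% X) x) (hY : CMDiffAt ∞ (T% Y) x)
    (hZ : CMDiffAt ∞ (T% Z) x) (w : TangentSpace I x) :
    g.inner x (curvatureField g X Y Z x) w
      = g.inner x (curvature (leviCivita g) x (X x) (Y x) (Z x)) w := by
  let X' : Π y : M, TangentSpace I y := FiberBundle.extend E (X x)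
  let Y' : Π y : M, TangentSpace I y := FiberBundle.extend E (Y x)
  let Z' : Π y : M, TangentSpace I y := FiberBundle.extend E (Z x)
  let W' : Π y : M, TangentSpace I y := FiberBundle.extend E w
  have hX' : CMDiffAt ∞ (T% X') x := FiberBundle.contMDiffAt_extend I E _
  have hY' : CMDiffAt ∞ (T% Y') x := FiberBundle.contMDiffAt_extend I E _
  have hZ' : CMDiffAt ∞ (T% Z') x := FiberBundle.contMDiffAt_extend I E _
  have hW' : CMDiffAt ∞ (T% W') x := FiberBundle.contMDiffAt_extend I E _
  have eX : X' x = X x := FiberBundle.extend_apply_self _ _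
  have eY : Y' x = Y x := FiberBundle.extend_apply_self _ _
  have eZ : Z' x = Z x := FiberBundle.extend_apply_self _ _
  have eW : W' x = w := FiberBundle.extend_apply_self _ _
  change _ = g.inner x (curvatureField g X' Y' Z' x) w
  rw [← eW, inner_curvatureField_skew g hX hY hZ hW', ← eZ,
    ← inner_curvatureField_skew g hX hY hZ' hW', inner_curvatureField_pair_symm g hX hY hZ' hW',
    inner_curvatureField_skew g hZ' hW' hX hY, ← eX, ← inner_curvatureField_skew g hZ' hW' hX' hY,
    ← eY, inner_curvatureField_pair_symm g hZ' hW' hX' hY']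

section Tensor

variable (u v w z : TangentSpace I x)

omit [Nontrivial E] in
theorem inner_curvature_swap : g.inner x (curvature (leviCivita g) x v u w) z
    = -g.inner x (curvature (leviCivita g) x u v w) z := by
  simp only [curvature_eq_curvatureField]
  rw [curvatureField_swap]
  simp

theorem inner_curvature_skew : g.inner x (curvature (leviCivita g) x u v w) z
    = -g.inner x (curvature (leviCivita g) x u v z) w := by
  have h := fun t : TangentSpace I x ↦ FiberBundle.contMDiffAt_extend (k := ∞) I E t
  simpa using! inner_curvatureField_skew g (h u) (h v) (h w) (h z)

theorem inner_curvature_pair_symm : g.inner x (curvature (leviCivita g) x u v w) z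
    = g.inner x (curvature (leviCivita g) x w z u) v := by
  have h := fun t : TangentSpace I x ↦ FiberBundle.contMDiffAt_extend (k := ∞) I E t
  simpa using! inner_curvatureField_pair_symm g (h u) (h v) (h w) (h z)

theorem inner_curvature_bianchi : g.inner x (curvature (leviCivita g) x u v w) z
    + g.inner x (curvature (leviCivita g) x v w u) z
    + g.inner x (curvature (leviCivita g) x w u v) z = 0 := by
  have h := fun t : TangentSpace I x ↦ FiberBundle.contMDiffAt_extend (k := ∞) I E t
  simp only [curvature_eq_curvatureField]
  rw [← add_apply, ← map_add, ← add_apply, ← map_add, curvatureField_bianchi g (h u) (h v) (h w)]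
  simp

end Tensor

end Curvature

section CurvatureLike

variable {V : Type*} [AddCommGroup V] [Module ℝ V] {S : V → V → V → V → ℝ}

omit [Module ℝ V] in
/-- An algebraic curvature tensor with vanishing sectional curvatures vanishes. -/
theorem curvatureLike_eq_zero (hadd : ∀ u v w z z', S u v w (z + z') = S u v w z + S u v w z')
    (hswap : ∀ u v w z, S v u w z = -S u v w z) (hskew : ∀ u v w z, S u v w z = -S u v z w)
    (hpair : ∀ u v w z, S u v w z = S w z u v)
    (hbianchi : ∀ u v w z, S u v w z + S v w u z + S w u v z = 0)
    (h0 : ∀ u v, S u v v u = 0) (u v w z : V) : S u v w z = 0 := by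
  have hadd3 : ∀ u v w w' z, S u v (w + w') z = S u v w z + S u v w' z := by
    intro u v w w' z
    rw [hskew, hadd, hskew u v w, hskew u v w']
    ring
  have hadd1 : ∀ u u' v w z, S (u + u') v w z = S u v w z + S u' v w z := by
    intro u u' v w z
    rw [hpair, hadd3, hpair u, hpair u']
  have hadd2 : ∀ u v v' w z, S u (v + v') w z = S u v w z + S u v' w z := by
    intro u v v' w z
    rw [hswap, hadd1, hswap u v, hswap u v']
    ring
  have h1 : ∀ u v w, S u v v w = 0 := by
    intro u v w
    have h := h0 (u + w) v
    rw [hadd1, hadd, hadd, h0, h0] at h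
    have h' : S w v v u = S u v v w := by
      rw [hpair, hswap, hskew]
      ring
    linarith
  have h2 : ∀ u v w z, S u w v z = -S u v w z := by
    intro u v w z
    have h := h1 u (v + w) z
    rw [hadd2, hadd3, hadd3, h1, h1] at h
    linarith
  have hb := hbianchi u v w z
  rw [h2 v u w z, hswap u v, hswap u w v z, h2 u v w z] at hb
  linarith

/-- An algebraic curvature tensor with constant sectional curvature `c` is `c` times the standard
one. -/
theorem curvatureLike_eq_of_sectional (B : V →ₗ[ℝ] V →ₗ[ℝ] ℝ) (hB : ∀ u v, B u v = B v u) {c : ℝ}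
    (hadd : ∀ u v w z z', S u v w (z + z') = S u v w z + S u v w z')
    (hswap : ∀ u v w z, S v u w z = -S u v w z) (hskew : ∀ u v w z, S u v w z = -S u v z w)
    (hpair : ∀ u v w z, S u v w z = S w z u v)
    (hbianchi : ∀ u v w z, S u v w z + S v w u z + S w u v z = 0)
    (h : ∀ u v, S u v v u = c * (B u u * B v v - B u v ^ 2)) (u v w z : V) :
    S u v w z = c * (B v w * B u z - B u w * B v z) := by
  have key := curvatureLike_eq_zero (V := V)
    (S := fun u v w z ↦ S u v w z - c * (B v w * B u z - B u w * B v z))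
    (fun u v w z z' ↦ by simp only [hadd, map_add]; ring)
    (fun u v w z ↦ by rw [hswap]; ring)
    (fun u v w z ↦ by rw [hskew]; ring)
    (fun u v w z ↦ by rw [hpair, hB v w, hB u z, hB u w, hB v z]; ring)
    (fun u v w z ↦ by
      rw [hB w u, hB u v, hB w v]
      linarith [hbianchi u v w z])
    (fun u v ↦ by simp only [h, hB v u]; ring) u v w z
  linarith

end CurvatureLike

section HermitianAlgebra

open Module

variable {V : Type*} [AddCommGroup V] [Module ℝ V]

/-- The imaginary part of the complex bivector `x ∧ y`, for the complex structure `J`, as a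
bilinear form. -/
def imWedge (B : V →ₗ[ℝ] V →ₗ[ℝ] ℝ) (J : V →ₗ[ℝ] V) (x y z w : V) : ℝ :=
  B x z * B (J y) w - B (J y) z * B x w + B (J x) z * B y w - B y z * B (J x) w

variable {B : V →ₗ[ℝ] V →ₗ[ℝ] ℝ} {J A : V →ₗ[ℝ] V} {c : ℝ} {q : V → V → ℝ}

section Wedge

variable (hJ : ∀ x, J (J x) = -x) (hJB : ∀ x y, B (J x) y = -B x (J y))

include hJ hJB in
theorem imWedge_J_left (x y z w : V) :
    imWedge B J (J x) y z w = -imWedge B J x y (J z) w := by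
  have h : ∀ x y, B x (J y) = -B (J x) y := fun x y ↦ by rw [hJB]; ring
  simp only [imWedge, h, hJ, map_neg, LinearMap.neg_apply]
  ring

include hJB in
theorem mem_span_of_imWedge_eq_zero (hB : ∀ x y, B x y = B y x) (hpos : ∀ x, x ≠ 0 → 0 < B x x)
    (hJ : ∀ x, J (J x) = -x) {x y : V} (hx : x ≠ 0)
    (h : ∀ z w, imWedge B J x y z w = 0) : y ∈ Submodule.span ℝ {x, J x} := by
  have hxJ : B (J x) x = 0 := by
    have h1 := hJB x x
    have h2 := hB (J x) x
    linarith
  let v := B x x • J y - B (J y) x • x - B y x • J x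
  have hv : v = 0 := by
    by_contra hne
    have h1 := h x v
    simp only [imWedge, hxJ] at h1
    have h2 : B v v = 0 := by
      conv_lhs => arg 1; simp only [v, map_sub, map_smul]
      simp only [LinearMap.sub_apply, LinearMap.smul_apply, smul_eq_mul]
      linarith
    exact (hpos v hne).ne' h2
  have hJv : B x x • y = B y x • x - B (J y) x • J x := by
    have h1 := congrArg J hv
    simp only [v, map_sub, map_smul, hJ, map_zero] at h1
    linear_combination (norm := module) -h1
  have hy : y = (B x x)⁻¹ • (B y x • x - B (J y) x • J x) := by
    rw [← hJv, inv_smul_smul₀ (hpos x hx).ne']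
  rw [hy]
  refine Submodule.smul_mem _ _ (Submodule.sub_mem _ ?_ ?_) <;>
    exact Submodule.smul_mem _ _ (Submodule.subset_span (by simp))

end Wedge

theorem finrank_span_pair_le (x y : V) : finrank ℝ (Submodule.span ℝ {x, y}) ≤ 2 := by
  classical
  have h := finrank_span_finset_le_card (R := ℝ) ({x, y} : Finset V)
  rw [Finset.coe_pair] at h
  exact h.trans Finset.card_le_two

/-- The pointwise form of the curvature identity for an almost contact metric structure of constant
horizontal sectional curvature `c`: it forces the horizontal space to have dimension `4`, and
determines when `A` is invertible. -/
theorem horizontal_dimension_and_bijective [FiniteDimensional ℝ V] {n : ℕ} (hn : 1 ≤ n)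
    (hdim : finrank ℝ V = 2 * n)
    (hB : ∀ x y, B x y = B y x) (hpos : ∀ x, x ≠ 0 → 0 < B x x)
    (hJ : ∀ x, J (J x) = -x) (hJB : ∀ x y, B (J x) y = -B x (J y))
    (hAJ : ∀ x, A (J x) = -J (A x))
    (hΩ : ∀ x, x ≠ 0 → ∃ y, B y (A x) - B x (A y) ≠ 0)
    (hR : ∀ x y z w, c * (B y (J z) * B x w - B x (J z) * B y w + B y z * B x (J w)
        - B x z * B y (J w))
      = -(B z (A y) * B (J w) (A x) + B (J z) (A y) * B w (A x))
        + (B z (A x) * B (J w) (A y) + B (J z) (A x) * B w (A y))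
        + (B y (A x) - B x (A y)) * q z w) :
    n = 2 ∧ (Function.Bijective A ↔ c ≠ 0) := by
  let Ω : V →ₗ[ℝ] V →ₗ[ℝ] ℝ := B.comp A - B.compl₂ A
  have Ω_apply : ∀ x y, Ω x y = B y (A x) - B x (A y) := fun x y ↦ by simp [Ω, hB y]
  have ΩJ : ∀ x, Ω x (J x) = 0 := fun x ↦ by
    rw [Ω_apply, hAJ, map_neg, hJB, hB x (J (A x))]
    linarith [hJB x (A x), hB (J x) (A x), hJB (A x) x, hB (J (A x)) x]
  have Ωself : ∀ x, Ω x x = 0 := fun x ↦ by rw [Ω_apply, sub_self]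
  have hJflip : ∀ x y, B x (J y) = -B (J x) y := fun x y ↦ by rw [hJB]; ring
  have e1 : ∀ x y z w, c * imWedge B J x y z w + imWedge B J (A x) (A y) z w = Ω x y * q z w := by
    intro x y z w
    have h := hR x y z w
    rw [Ω_apply]
    simp only [hJflip x, hJflip y, hJB w, hJB z, hB z, hB w] at h
    simp only [imWedge]
    linarith [h]
  have e2 : ∀ x y z w, c * imWedge B J x y z w - imWedge B J (A x) (A y) z w
      = Ω (J x) y * q (J z) w := by
    intro x y z w
    rw [← e1 (J x) y (J z) w, imWedge_J_left hJ hJB x, hAJ, hJ]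
    have h1 : imWedge B J (-J (A x)) (A y) (J z) w = -imWedge B J (J (A x)) (A y) (J z) w := by
      simp only [imWedge, map_neg, LinearMap.neg_apply]; ring
    have h2 : ∀ x y, imWedge B J x y (-z) w = -imWedge B J x y z w := fun x y ↦ by
      simp only [imWedge, map_neg]; ring
    rw [h1, imWedge_J_left hJ hJB (A x), hJ, h2, h2]
    ring
  have : Nontrivial V := nontrivial_of_finrank_pos (R := ℝ) (by omega)
  obtain ⟨x₀, hx₀⟩ := exists_ne (0 : V)
  have hΩne : ∀ x, x ≠ 0 → ∃ y, Ω x y ≠ 0 := by simpa only [Ω_apply] using hΩ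
  have q_neg : ∀ z w, q (-z) w = -q z w := by
    intro z w
    obtain ⟨y₀, hy₀⟩ := hΩne x₀ hx₀
    have h1 := e1 x₀ y₀ z w
    have h2 := e1 x₀ y₀ (-z) w
    have h3 : Ω x₀ y₀ * (q (-z) w + q z w) = 0 := by
      rw [mul_add, ← h1, ← h2]
      simp only [imWedge, map_neg]; ring
    linarith [(mul_eq_zero.1 h3).resolve_left hy₀]
  have q_zero : ∀ ε : ℝ, (∃ x y, Ω x y ≠ 0 ∧ ∀ z w, Ω x y * q z w = ε * (Ω (J x) y * q (J z) w)) →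
      ∀ z w, q z w = 0 := by
    rintro ε ⟨x, y, hxy, h⟩ z w
    have h1 := h z w
    have h2 := h (J z) w
    rw [hJ, q_neg] at h2
    have h3 : (Ω x y ^ 2 + (ε * Ω (J x) y) ^ 2) * q z w = 0 := by
      linear_combination Ω x y * h1 + ε * Ω (J x) y * h2
    exact (mul_eq_zero.1 h3).resolve_left (by positivity)
  -- a complex line is not symplectic
  have hspan : ∀ x, x ≠ 0 → ∃ y, y ∉ Submodule.span ℝ {x, J x} := by
    intro x hx
    obtain ⟨y, hy⟩ := hΩne x hx
    refine ⟨y, fun hmem ↦ hy ?_⟩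
    obtain ⟨a, b, rfl⟩ := Submodule.mem_span_pair.1 hmem
    simp [Ωself, ΩJ]
  have hn1 : n ≠ 1 := by
    rintro rfl
    obtain ⟨y, hy⟩ := hspan x₀ hx₀
    refine hy ?_
    have hli : LinearIndependent ℝ ![x₀, J x₀] := by
      rw [LinearIndependent.pair_iff]
      intro s t hst
      have h0 := congrArg J hst
      simp only [map_add, map_smul, hJ, map_zero] at h0
      have h1 : (s ^ 2 + t ^ 2) • x₀ = 0 := by
        linear_combination (norm := module) s • hst - t • h0
      have h2 := (smul_eq_zero.1 h1).resolve_right hx₀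
      constructor <;> nlinarith
    have htop := hli.span_eq_top_of_card_eq_finrank (by simp [hdim])
    rw [Matrix.range_cons_cons_empty] at htop
    rw [htop]
    trivial
  by_cases hc : c = 0
  · subst hc
    have hq : ∀ z w, q z w = 0 := by
      obtain ⟨y₀, hy₀⟩ := hΩne x₀ hx₀
      refine q_zero (-1) ⟨x₀, y₀, hy₀, fun z w ↦ ?_⟩
      linarith [e1 x₀ y₀ z w, e2 x₀ y₀ z w]
    have hA : ∀ x y z w, imWedge B J (A x) (A y) z w = 0 := by
      intro x y z w
      have h := e1 x y z w
      rw [hq] at h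
      linarith
    have hAne : ∃ a, A a ≠ 0 := by
      by_contra! h0
      obtain ⟨y₀, hy₀⟩ := hΩne x₀ hx₀
      exact hy₀ (by rw [Ω_apply, h0, h0]; simp)
    obtain ⟨a, ha⟩ := hAne
    have hrange : ∀ y, A y ∈ Submodule.span ℝ {A a, J (A a)} := fun y ↦
      mem_span_of_imWedge_eq_zero hJB hB hpos hJ ha (hA a y)
    have hn2 : n = 2 := by
      let f : V →ₗ[ℝ] Submodule.span ℝ {A a, J (A a)} × ℝ × ℝ :=
        (A.codRestrict _ hrange).prod ((B (A a)).prod (B (J (A a))))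
      have hf : Function.Injective f := by
        rw [← LinearMap.ker_eq_bot, LinearMap.ker_eq_bot']
        intro x hx
        by_contra hne
        obtain ⟨y, hy⟩ := hΩne x hne
        have h1 : A x = 0 := congrArg (fun p ↦ (p.1 : V)) hx
        have h2 : B (A a) x = 0 := congrArg (fun p ↦ p.2.1) hx
        have h3 : B (J (A a)) x = 0 := congrArg (fun p ↦ p.2.2) hx
        refine hy ?_
        obtain ⟨s, t, hst⟩ := Submodule.mem_span_pair.1 (hrange y)
        rw [Ω_apply, h1, ← hst, hB x]
        simp [h2, h3]
      have h := LinearMap.finrank_le_finrank_of_injective hf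
      have h2 := finrank_span_pair_le (A a) (J (A a))
      simp only [finrank_prod, finrank_self] at h
      omega
    refine ⟨hn2, ?_⟩
    simp only [ne_eq, not_true_eq_false, iff_false]
    intro hbij
    obtain ⟨y, hy⟩ := hspan (A a) ha
    obtain ⟨x, rfl⟩ := hbij.2 y
    exact hy (hrange x)
  · have hn2 : n = 2 := by
      let f : V →ₗ[ℝ] ℝ × ℝ := (Ω x₀).prod (Ω (J x₀))
      have hker : LinearMap.ker f ≤ Submodule.span ℝ {x₀, J x₀} := by
        intro y hy
        have hy1 : Ω x₀ y = 0 := congrArg Prod.fst (LinearMap.mem_ker.1 hy)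
        have hy2 : Ω (J x₀) y = 0 := congrArg Prod.snd (LinearMap.mem_ker.1 hy)
        refine mem_span_of_imWedge_eq_zero hJB hB hpos hJ hx₀ fun z w ↦ ?_
        have h1 := e1 x₀ y z w
        have h2 := e2 x₀ y z w
        rw [hy1] at h1
        rw [hy2] at h2
        have h3 : c * imWedge B J x₀ y z w = 0 := by linarith
        exact (mul_eq_zero.1 h3).resolve_left hc
      have h1 := LinearMap.finrank_range_add_finrank_ker f
      have h2 := Submodule.finrank_mono hker
      have h3 := finrank_span_pair_le x₀ (J x₀)
      have h4 := Submodule.finrank_le (LinearMap.range f)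
      simp only [finrank_prod, finrank_self] at h4
      omega
    refine ⟨hn2, iff_of_true ?_ hc⟩
    have hinj : Function.Injective A := by
      rw [← LinearMap.ker_eq_bot, LinearMap.ker_eq_bot']
      intro x hx
      by_contra hne
      have h0 : ∀ y z w, imWedge B J (A x) (A y) z w = 0 := by
        intro y z w
        simp [imWedge, hx]
      obtain ⟨y₀, hy₀⟩ := hΩne x hne
      have hq : ∀ z w, q z w = 0 := by
        refine q_zero 1 ⟨x, y₀, hy₀, fun z w ↦ ?_⟩
        linarith [e1 x y₀ z w, e2 x y₀ z w, h0 y₀ z w]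
      obtain ⟨y, hy⟩ := hspan x hne
      refine hy (mem_span_of_imWedge_eq_zero hJB hB hpos hJ hne fun z w ↦ ?_)
      have h1 := e1 x y z w
      rw [h0, hq, mul_zero, add_zero] at h1
      exact (mul_eq_zero.1 h1).resolve_left hc
    exact ⟨hinj, LinearMap.injective_iff_surjective.1 hinj⟩

end HermitianAlgebra

namespace AlmostContactMetricStructure
variable {E : Type*} [NormedAddCommGroup E] [NormedSpace ℝ E]
  {H : Type*} [TopologicalSpace H] {I : ModelWithCorners ℝ E H}
  {M : Type*} [TopologicalSpace M] [ChartedSpace H M] [IsManifold I ∞ M]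
  (S : AlmostContactMetricStructure I M) {x : M}

section Pointwise

theorem mem_D {v : TangentSpace I x} : v ∈ S.D x ↔ S.η x v = 0 := Iff.rfl

theorem ξ_ne_zero : S.ξ x ≠ 0 := fun h ↦ by simpa [h] using S.η_ξ x

theorem φ_ξ : S.φ x (S.ξ x) = 0 := by
  have h1 : S.φ x (S.φ x (S.ξ x)) = 0 := by simp [S.φ_φ, S.η_ξ]
  have h2 : S.φ x (S.ξ x) = S.η x (S.φ x (S.ξ x)) • S.ξ x := by
    have h := S.φ_φ x (S.φ x (S.ξ x))
    rw [h1, map_zero] at h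
    exact (neg_add_eq_zero.1 h.symm)
  have h3 : (S.η x (S.φ x (S.ξ x)) * S.η x (S.φ x (S.ξ x))) • S.ξ x = 0 := by
    rw [mul_smul, ← h2, ← map_smul, ← h2, h1]
  have h4 := mul_self_eq_zero.1 ((smul_eq_zero.1 h3).resolve_right S.ξ_ne_zero)
  rw [h2, h4, zero_smul]

theorem η_φ (v : TangentSpace I x) : S.η x (S.φ x v) = 0 := by
  have h := S.φ_φ x (S.φ x v)
  rw [S.φ_φ x v, map_add, map_neg, map_smul, S.φ_ξ, smul_zero, add_zero, left_eq_add] at h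
  exact (smul_eq_zero.1 h).resolve_right S.ξ_ne_zero

theorem inner_ξ_left (v : TangentSpace I x) : S.g.inner x (S.ξ x) v = S.η x v := by
  have h := S.inner_φ_φ x (S.ξ x) v
  rw [S.φ_ξ, S.η_ξ] at h
  simp at h
  linarith

theorem inner_ξ_right (v : TangentSpace I x) : S.g.inner x v (S.ξ x) = S.η x v := by
  rw [S.g.symm, S.inner_ξ_left]

theorem inner_φ_left (u v : TangentSpace I x) :
    S.g.inner x (S.φ x u) v = -S.g.inner x u (S.φ x v) := by
  have h := S.inner_φ_φ x u (S.φ x v)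
  rw [S.φ_φ, S.η_φ, map_add, map_neg, map_smul, S.inner_ξ_right, S.η_φ] at h
  simp at h
  linarith

/-- The horizontal part of a tangent vector. -/
def hor (x : M) (v : TangentSpace I x) : TangentSpace I x := v - S.η x v • S.ξ x

theorem hor_mem (v : TangentSpace I x) : S.hor x v ∈ S.D x := by
  simp [mem_D, hor, S.η_ξ]

theorem hor_eq {v : TangentSpace I x} (hv : v ∈ S.D x) : S.hor x v = v := by
  simp [hor, S.mem_D.1 hv]

theorem φ_mem (v : TangentSpace I x) : S.φ x v ∈ S.D x := S.η_φ v

theorem φ_hor (v : TangentSpace I x) : S.φ x (S.hor x v) = S.φ x v := by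
  simp [hor, S.φ_ξ]

end Pointwise

section Fields

variable {Y Z W X : Π x : M, TangentSpace I x}

theorem contMDiffAt_φ_apply (hY : CMDiffAt ∞ (T% Y) x) :
    CMDiffAt ∞ (T% (fun y ↦ S.φ y (Y y))) x :=
  ContMDiffAt.clm_bundle_apply (F₁ := E) (F₂ := E) (S.contMDiff_φ x) hY

theorem mdifferentiableAt_φ_apply (hY : MDiffAt (T% Y) x) :
    MDiffAt (T% (fun y ↦ S.φ y (Y y))) x :=
  MDifferentiableAt.clm_bundle_apply (F₁ := E) (F₂ := E)
    ((S.contMDiff_φ x).mdifferentiableAt (by simp)) hY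

theorem contMDiffAt_hor (hY : CMDiffAt ∞ (T% Y) x) :
    CMDiffAt ∞ (T% (fun y ↦ S.hor y (Y y))) x := by
  have h : CMDiffAt ∞ (fun y ↦ S.η y (Y y)) x := by
    simp only [← S.inner_ξ_left]
    exact contMDiffAt_inner S.g (S.contMDiff_ξ x) hY
  exact hY.sub_section (h.smul_section (S.contMDiff_ξ x))

theorem mdifferentiableAt_ξ : MDiffAt (T% S.ξ) x := (S.contMDiff_ξ x).mdifferentiableAt (by simp)

variable [FiniteDimensional ℝ E]

theorem A_mem (v : TangentSpace I x) : S.A x v ∈ S.D x := by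
  have hv := FiberBundle.mdifferentiableAt_extend I E v
  have h := leviCivita_metric S.g hv S.mdifferentiableAt_ξ S.mdifferentiableAt_ξ
  simp only [S.inner_ξ_left, S.η_ξ, S.inner_ξ_right, mvfderiv_const] at h
  simp at h
  rw [mem_D, A]
  linarith

theorem extDerivOneForm_η (u v : TangentSpace I x) :
    extDerivOneForm S.η x u v = 1 / 2 * (S.g.inner x (S.A x u) v - S.g.inner x (S.A x v) u) := by
  have hu := FiberBundle.mdifferentiableAt_extend I E u
  have hv := FiberBundle.mdifferentiableAt_extend I E v
  have h1 := leviCivita_metric S.g hu S.mdifferentiableAt_ξ hv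
  have h2 := leviCivita_metric S.g hv S.mdifferentiableAt_ξ hu
  simp only [extDerivOneForm, ← S.inner_ξ_left, ← leviCivita_torsion S.g hu hv, h1, h2]
  simp [A]
  ring

/-- `g(∇_u ξ, Y) = -η(∇_u Y)` for a horizontal field `Y`. -/
theorem η_leviCivita (hY : MDiffAt (T% Y) x) (hYD : ∀ y, Y y ∈ S.D y) (u : TangentSpace I x) :
    S.η x (leviCivita S.g Y x u) = -S.g.inner x (Y x) (S.A x u) := by
  have hu := FiberBundle.mdifferentiableAt_extend I E u
  have h := leviCivita_metric S.g hu S.mdifferentiableAt_ξ hY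
  have h0 : ∀ y, S.g.inner y (S.ξ y) (Y y) = 0 := fun y ↦ by
    rw [S.inner_ξ_left]; exact hYD y
  simp only [h0, mvfderiv_const, S.inner_ξ_left] at h
  simp at h
  rw [S.g.symm]
  simp only [A]
  linarith

theorem inner_nablaEndo_φ (hY : MDiffAt (T% Y) x) (u w : TangentSpace I x) :
    S.g.inner x (nablaEndo (leviCivita S.g) S.φ x u (Y x)) w
      = S.g.inner x (leviCivita S.g (fun y ↦ S.φ y (Y y)) x u) w
        + S.g.inner x (leviCivita S.g Y x u) (S.φ x w) := by
  have skew : ∀ {Y W : Π x : M, TangentSpace I x}, MDiffAt (T% Y) x → MDiffAt (T% W) x →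
      S.g.inner x (leviCivita S.g (fun y ↦ S.φ y (Y y)) x u) (W x)
        + S.g.inner x (leviCivita S.g Y x u) (S.φ x (W x))
      = -(S.g.inner x (leviCivita S.g (fun y ↦ S.φ y (W y)) x u) (Y x)
        + S.g.inner x (leviCivita S.g W x u) (S.φ x (Y x))) := by
    intro Y W hY hW
    have hu := FiberBundle.mdifferentiableAt_extend I E u
    have h1 := leviCivita_metric S.g hu (S.mdifferentiableAt_φ_apply hY) hW
    have h2 := leviCivita_metric S.g hu hY (S.mdifferentiableAt_φ_apply hW)
    simp only [S.inner_φ_left, mvfderiv_fun_neg] at h1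
    simp at h1 h2
    rw [S.g.symm x _ (Y x), S.g.symm x _ (S.φ x (Y x)), S.inner_φ_left]
    linarith
  have hw := FiberBundle.mdifferentiableAt_extend I E w
  have hY' := FiberBundle.mdifferentiableAt_extend I E (Y x)
  have h1 := skew hY hw
  have h2 := skew hY' hw
  simp only [FiberBundle.extend_apply_self] at h1 h2
  rw [h1, ← h2]
  simp [nablaEndo, S.inner_φ_left]

end Fields

section CurvatureIdentity
variable {E : Type*} [NormedAddCommGroup E] [NormedSpace ℝ E] [FiniteDimensional ℝ E]
  {H : Type*} [TopologicalSpace H] {I : ModelWithCorners ℝ E H}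
  {M : Type*} [TopologicalSpace M] [ChartedSpace H M] [IsManifold I ∞ M]
  (S : AlmostContactMetricStructure I M) {x : M} {Y Z W X : Π x : M, TangentSpace I x}

/-- `φ` is parallel along horizontal directions, up to vertical terms. -/
def IsHorizontallyParallel : Prop :=
  ∀ (x : M), ∀ u ∈ S.D x, ∀ v ∈ S.D x, ∀ w ∈ S.D x,
    S.g.inner x (nablaEndo (leviCivita S.g) S.φ x u v) w = 0

variable {S} (hφ : S.IsHorizontallyParallel)
include hφ

theorem inner_leviCivita_φ (hZ : MDiffAt (T% Z) x) (hZD : ∀ y, Z y ∈ S.D y)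
    {u w : TangentSpace I x} (hu : u ∈ S.D x) (hw : w ∈ S.D x) :
    S.g.inner x (leviCivita S.g (fun y ↦ S.φ y (Z y)) x u) w
      = -S.g.inner x (leviCivita S.g Z x u) (S.φ x w) := by
  have h := S.inner_nablaEndo_φ hZ u w
  rw [hφ x u hu _ (hZD x) w hw] at h
  linarith

theorem inner_nablaEndo_eq_η_mul (hZ : MDiffAt (T% Z) x) (hZD : ∀ y, Z y ∈ S.D y)
    (u : TangentSpace I x) {w : TangentSpace I x} (hw : w ∈ S.D x) :
    S.g.inner x (nablaEndo (leviCivita S.g) S.φ x u (Z x)) w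
      = S.η x u * S.g.inner x (nablaEndo (leviCivita S.g) S.φ x (S.ξ x) (Z x)) w := by
  have h := hφ x _ (S.hor_mem u) _ (hZD x) w hw
  rw [S.inner_nablaEndo_φ hZ] at h ⊢
  rw [S.inner_nablaEndo_φ hZ]
  simp only [hor, map_sub, map_smul, sub_apply, smul_apply, smul_eq_mul] at h
  linarith

/-- The inner products of the derivatives of horizontal fields `Z`, `W` and of `φ Z`, `φ W`. -/
theorem inner_leviCivita_leviCivita_φ (hZ : MDiffAt (T% Z) x) (hW : MDiffAt (T% W) x)
    (hZD : ∀ y, Z y ∈ S.D y) (hWD : ∀ y, W y ∈ S.D y)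
    {u v : TangentSpace I x} (hu : u ∈ S.D x) (hv : v ∈ S.D x) :
    S.g.inner x (leviCivita S.g (fun y ↦ S.φ y (Z y)) x v) (leviCivita S.g W x u)
      + S.g.inner x (leviCivita S.g Z x v) (leviCivita S.g (fun y ↦ S.φ y (W y)) x u)
    = S.g.inner x (Z x) (S.A x v) * S.g.inner x (S.φ x (W x)) (S.A x u)
      + S.g.inner x (S.φ x (Z x)) (S.A x v) * S.g.inner x (W x) (S.A x u) := by
  have a1 := inner_leviCivita_φ hφ hZ hZD hv (S.hor_mem (leviCivita S.g W x u))
  have a2 := inner_leviCivita_φ hφ hW hWD hu (S.hor_mem (leviCivita S.g Z x v))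
  have b1 := S.η_leviCivita (S.mdifferentiableAt_φ_apply hZ) (fun y ↦ S.φ_mem (Z y)) v
  have b2 := S.η_leviCivita (S.mdifferentiableAt_φ_apply hW) (fun y ↦ S.φ_mem (W y)) u
  have c1 := S.η_leviCivita hZ hZD v
  have c2 := S.η_leviCivita hW hWD u
  rw [S.φ_hor] at a1 a2
  simp only [hor, map_sub, map_smul, smul_eq_mul, S.inner_ξ_right, b1, b2, c1, c2] at a1 a2
  have d := S.inner_φ_left (leviCivita S.g Z x v) (leviCivita S.g W x u)
  rw [S.g.symm x (S.φ x _)] at d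
  rw [S.g.symm x (leviCivita S.g Z x v) (leviCivita S.g (fun y ↦ S.φ y (W y)) x u)]
  linarith

variable [Nontrivial E]

theorem inner_curvatureField_φ (hX : CMDiffAt ∞ (T% X) x) (hY : CMDiffAt ∞ (T% Y) x)
    (hZ : CMDiffAt ∞ (T% Z) x) (hW : CMDiffAt ∞ (T% W) x) (hXD : ∀ y, X y ∈ S.D y)
    (hYD : ∀ y, Y y ∈ S.D y) (hZD : ∀ y, Z y ∈ S.D y) (hWD : ∀ y, W y ∈ S.D y) :
    S.g.inner x (curvatureField S.g X Y (fun y ↦ S.φ y (Z y)) x) (W x)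
      + S.g.inner x (curvatureField S.g X Y Z x) (S.φ x (W x))
    = -(S.g.inner x (Z x) (S.A x (Y x)) * S.g.inner x (S.φ x (W x)) (S.A x (X x))
        + S.g.inner x (S.φ x (Z x)) (S.A x (Y x)) * S.g.inner x (W x) (S.A x (X x)))
      + (S.g.inner x (Z x) (S.A x (X x)) * S.g.inner x (S.φ x (W x)) (S.A x (Y x))
        + S.g.inner x (S.φ x (Z x)) (S.A x (X x)) * S.g.inner x (W x) (S.A x (Y x)))
      + (S.g.inner x (Y x) (S.A x (X x)) - S.g.inner x (X x) (S.A x (Y x)))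
        * S.g.inner x (nablaEndo (leviCivita S.g) S.φ x (S.ξ x) (Z x)) (W x) := by
  have hφZ := S.contMDiffAt_φ_apply hZ
  have hφW := S.contMDiffAt_φ_apply hW
  have hW' := hW.mdifferentiableAt (n := ∞) (by simp)
  have hZ' := hZ.mdifferentiableAt (n := ∞) (by simp)
  have hφW' := hφW.mdifferentiableAt (n := ∞) (by simp)
  have second : ∀ {U V : Π y : M, TangentSpace I y}, CMDiffAt ∞ (T% U) x → CMDiffAt ∞ (T% V) x →
      (∀ y, V y ∈ S.D y) →
      S.g.inner x (leviCivita S.g (fun y ↦ leviCivita S.g (fun z ↦ S.φ z (Z z)) y (V y)) x (U x))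
          (W x)
        + S.g.inner x (leviCivita S.g (fun z ↦ S.φ z (Z z)) x (V x)) (leviCivita S.g W x (U x))
        + S.g.inner x (leviCivita S.g (fun y ↦ leviCivita S.g Z y (V y)) x (U x)) (S.φ x (W x))
        + S.g.inner x (leviCivita S.g Z x (V x))
          (leviCivita S.g (fun z ↦ S.φ z (W z)) x (U x)) = 0 := by
    intro U V hU hV hVD
    have hU' := hU.mdifferentiableAt (n := ∞) (by simp)
    have h1 := (contMDiffAt_leviCivita S.g hV hφZ).mdifferentiableAt (by simp)
    have h2 := (contMDiffAt_leviCivita S.g hV hZ).mdifferentiableAt (by simp)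
    have h : (fun y ↦ S.g.inner y (leviCivita S.g (fun z ↦ S.φ z (Z z)) y (V y)) (W y)
        + S.g.inner y (leviCivita S.g Z y (V y)) (S.φ y (W y))) =ᶠ[nhds x] fun _ ↦ (0 : ℝ) := by
      filter_upwards [eventually_mdifferentiableAt_section hZ] with y hZy
      rw [inner_leviCivita_φ hφ hZy hZD (hVD y) (hWD y)]
      ring
    have hd := congrArg (fun l ↦ l (U x)) (mvfderiv_congr (I := I) h)
    simp only [mvfderiv_const, mvfderiv_fun_add (mdifferentiableAt_metric S.g h1 hW')
      (mdifferentiableAt_metric S.g h2 hφW'), add_apply, leviCivita_metric S.g hU' h1 hW',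
      leviCivita_metric S.g hU' h2 hφW', zero_apply] at hd
    linarith
  have s1 := second hX hY hYD
  have s2 := second hY hX hXD
  have t1 := inner_leviCivita_leviCivita_φ hφ hZ' hW' hZD hWD (hXD x) (hYD x)
  have t2 := inner_leviCivita_leviCivita_φ hφ hZ' hW' hZD hWD (hYD x) (hXD x)
  have k1 := S.inner_nablaEndo_φ hZ' (mlieBracket I X Y x) (W x)
  rw [inner_nablaEndo_eq_η_mul hφ hZ' hZD _ (hWD x)] at k1
  have hX' := hX.mdifferentiableAt (n := ∞) (by simp)
  have hY' := hY.mdifferentiableAt (n := ∞) (by simp)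
  have hη : S.η x (mlieBracket I X Y x)
      = -(S.g.inner x (Y x) (S.A x (X x)) - S.g.inner x (X x) (S.A x (Y x))) := by
    rw [← leviCivita_torsion S.g hX' hY', map_sub, S.η_leviCivita hX' hXD, S.η_leviCivita hY' hYD]
    ring
  rw [hη] at k1
  simp only [curvatureField, map_sub, sub_apply]
  linarith

theorem inner_curvature_φ {u v w z : TangentSpace I x} (hu : u ∈ S.D x) (hv : v ∈ S.D x)
    (hw : w ∈ S.D x) (hz : z ∈ S.D x) :
    S.g.inner x (curvature (leviCivita S.g) x u v (S.φ x w)) z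
      + S.g.inner x (curvature (leviCivita S.g) x u v w) (S.φ x z)
    = -(S.g.inner x w (S.A x v) * S.g.inner x (S.φ x z) (S.A x u)
        + S.g.inner x (S.φ x w) (S.A x v) * S.g.inner x z (S.A x u))
      + (S.g.inner x w (S.A x u) * S.g.inner x (S.φ x z) (S.A x v)
        + S.g.inner x (S.φ x w) (S.A x u) * S.g.inner x z (S.A x v))
      + (S.g.inner x v (S.A x u) - S.g.inner x u (S.A x v))
        * S.g.inner x (nablaEndo (leviCivita S.g) S.φ x (S.ξ x) w) z := by
  let F : TangentSpace I x → Π y : M, TangentSpace I y :=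
    fun t y ↦ S.hor y (FiberBundle.extend E t y)
  have hF : ∀ t, CMDiffAt ∞ (T% (F t)) x :=
    fun t ↦ S.contMDiffAt_hor (FiberBundle.contMDiffAt_extend I E t)
  have hFD : ∀ t y, F t y ∈ S.D y := fun t y ↦ S.hor_mem _
  have hFx : ∀ {t}, t ∈ S.D x → F t x = t := fun {t} ht ↦ by
    simp only [F, FiberBundle.extend_apply_self]
    exact S.hor_eq ht
  have h := inner_curvatureField_φ hφ (hF u) (hF v) (hF w) (hF z) (hFD u) (hFD v) (hFD w) (hFD z)
  rw [inner_curvatureField_eq S.g (hF u) (hF v) (S.contMDiffAt_φ_apply (hF w)),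
    inner_curvatureField_eq S.g (hF u) (hF v) (hF w)] at h
  simpa only [hFx hu, hFx hv, hFx hw, hFx hz] using h

end CurvatureIdentity
end AlmostContactMetricStructure

section Contact

open Module

variable {V : Type*} [AddCommGroup V] [Module ℝ V]

/-- The multilinear form `η ⊗ B ⊗ ⋯ ⊗ B`, with `n` factors `B`. -/
def tensorPow (n : ℕ) (η : V →ₗ[ℝ] ℝ) (B : V →ₗ[ℝ] V →ₗ[ℝ] ℝ) :
    MultilinearMap ℝ (fun _ : Fin (2 * n + 1) ↦ V) ℝ := by
  let a : Fin n → Fin (2 * n + 1) := fun i ↦ ⟨2 * (i : ℕ) + 1, by omega⟩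
  let b : Fin n → Fin (2 * n + 1) := fun i ↦ ⟨2 * (i : ℕ) + 2, by omega⟩
  let m : (Fin (2 * n + 1) → V) → ℝ := fun v ↦ η (v 0) * ∏ i : Fin n, B (v (a i)) (v (b i))
  have key : ∀ [DecidableEq (Fin (2 * n + 1))] (v : Fin (2 * n + 1) → V) (j : Fin (2 * n + 1)),
      ∃ L : V →ₗ[ℝ] ℝ, ∀ t, m (Function.update v j t) = L t := by
    intro _ v j
    have h0 : j.val = 0 ∨ (∃ k : Fin n, j = a k) ∨ ∃ k : Fin n, j = b k := by
      rcases Nat.eq_zero_or_pos j.val with h | h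
      · exact .inl h
      rcases Nat.even_or_odd' j.val with ⟨k, hk | hk⟩
      · exact .inr (.inr ⟨⟨k - 1, by omega⟩, Fin.ext (by simp only [b]; omega)⟩)
      · exact .inr (.inl ⟨⟨k, by omega⟩, Fin.ext (by simp only [a]; omega)⟩)
    have ha0 : ∀ i, (0 : Fin (2 * n + 1)) ≠ a i := fun i h ↦ by simp [a, Fin.ext_iff] at h
    have hb0 : ∀ i, (0 : Fin (2 * n + 1)) ≠ b i := fun i h ↦ by simp [b, Fin.ext_iff] at h
    have hab : ∀ i k, a i ≠ b k := fun i k h ↦ by simp [a, b, Fin.ext_iff] at h; omega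
    have haa : ∀ i k, i ≠ k → a i ≠ a k := fun i k hik h ↦ by
      simp [a, Fin.ext_iff] at h hik; omega
    have hbb : ∀ i k, i ≠ k → b i ≠ b k := fun i k hik h ↦ by
      simp [b, Fin.ext_iff] at h hik; omega
    rcases h0 with h | ⟨k, rfl⟩ | ⟨k, rfl⟩
    · obtain rfl : j = 0 := Fin.ext h
      refine ⟨(∏ i : Fin n, B (v (a i)) (v (b i))) • η, fun t ↦ ?_⟩
      simp [m, Function.update_of_ne (ha0 _).symm, Function.update_of_ne (hb0 _).symm, mul_comm]
    · refine ⟨(η (v 0) * ∏ i ∈ Finset.univ.erase k, B (v (a i)) (v (b i))) • B.flip (v (b k)),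
        fun t ↦ ?_⟩
      have h1 : ∀ i ∈ Finset.univ.erase k, B (Function.update v (a k) t (a i))
          (Function.update v (a k) t (b i)) = B (v (a i)) (v (b i)) := fun i hi ↦ by
        rw [Function.update_of_ne (haa i k (Finset.ne_of_mem_erase hi)),
          Function.update_of_ne (hab k i).symm]
      simp only [m]
      rw [← Finset.mul_prod_erase _ _ (Finset.mem_univ k), Finset.prod_congr rfl h1,
        Function.update_self, Function.update_of_ne (hab k k).symm, Function.update_of_ne (ha0 k)]
      simp only [LinearMap.smul_apply, LinearMap.flip_apply, smul_eq_mul]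
      ring
    · refine ⟨(η (v 0) * ∏ i ∈ Finset.univ.erase k, B (v (a i)) (v (b i))) • B (v (a k)),
        fun t ↦ ?_⟩
      have h1 : ∀ i ∈ Finset.univ.erase k, B (Function.update v (b k) t (a i))
          (Function.update v (b k) t (b i)) = B (v (a i)) (v (b i)) := fun i hi ↦ by
        rw [Function.update_of_ne (hbb i k (Finset.ne_of_mem_erase hi)),
          Function.update_of_ne (hab i k)]
      simp only [m]
      rw [← Finset.mul_prod_erase _ _ (Finset.mem_univ k), Finset.prod_congr rfl h1,
        Function.update_self, Function.update_of_ne (hab k k), Function.update_of_ne (hb0 k)]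
      simp only [LinearMap.smul_apply, smul_eq_mul]
      ring
  exact
    { toFun := m
      map_update_add' := fun v j s t ↦ by
        obtain ⟨L, hL⟩ := key v j
        rw [hL, hL, hL, map_add]
      map_update_smul' := fun v j c t ↦ by
        obtain ⟨L, hL⟩ := key v j
        rw [hL, hL, map_smul] }

theorem tensorPow_apply (n : ℕ) (η : V →ₗ[ℝ] ℝ) (B : V →ₗ[ℝ] V →ₗ[ℝ] ℝ)
    (v : Fin (2 * n + 1) → V) : tensorPow n η B v = η (v 0) * ∏ i : Fin n,
      B (v ⟨2 * (i : ℕ) + 1, by omega⟩) (v ⟨2 * (i : ℕ) + 2, by omega⟩) := rfl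

theorem finrank_ker_of_apply_eq_one [FiniteDimensional ℝ V] {n : ℕ}
    (hV : finrank ℝ V = n + 1) {η : V →ₗ[ℝ] ℝ} {ξ : V} (hξ : η ξ = 1) :
    finrank ℝ (LinearMap.ker η) = n := by
  have h := LinearMap.finrank_range_add_finrank_ker η
  have h1 : LinearMap.range η = ⊤ := LinearMap.range_eq_top.2 fun r ↦ ⟨r • ξ, by simp [hξ]⟩
  rw [h1, finrank_top, finrank_self] at h
  omega

/-- If the alternation of `η ⊗ B ⊗ ⋯ ⊗ B` is nonzero, then `B` is nondegenerate on `ker η`. -/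
theorem exists_apply_ne_zero_of_alternatization_ne_zero [FiniteDimensional ℝ V] {n : ℕ}
    (hV : finrank ℝ V = 2 * n + 1) {η : V →ₗ[ℝ] ℝ} {B : V →ₗ[ℝ] V →ₗ[ℝ] ℝ}
    (hB : ∀ x y, B y x = -B x y) {ξ : V} (hξ : η ξ = 1)
    (hne : MultilinearMap.alternatization (tensorPow n η B) ≠ 0) {x : V} (hx : η x = 0)
    (hx0 : x ≠ 0) : ∃ y, η y = 0 ∧ B x y ≠ 0 := by
  by_contra! hdeg
  let D := LinearMap.ker η
  have hD : finrank ℝ D = 2 * n := finrank_ker_of_apply_eq_one hV hξ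
  let x' : D := ⟨x, hx⟩
  have hx' : x' ≠ 0 := fun h ↦ hx0 (congrArg Subtype.val h)
  have hli : LinearIndepOn ℝ id ({x'} : Set D) := LinearIndepOn.singleton hx'
  let b₀ := Basis.extend hli
  have : Fintype (hli.extend (Set.subset_univ _)) := FiniteDimensional.fintypeBasisIndex b₀
  let eqv := Fintype.equivFinOfCardEq ((finrank_eq_card_basis b₀).symm.trans hD)
  let b : Basis (Fin (2 * n)) ℝ D := b₀.reindex eqv
  obtain ⟨k, hk⟩ : ∃ k, b k = x' :=
    ⟨eqv ⟨x', hli.subset_extend _ rfl⟩, by simp [b, b₀]⟩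
  let e : Basis (Fin (2 * n + 1)) ℝ V := Basis.mkFinCons ξ b
    (fun c y hy h ↦ by
      have h1 := congrArg η h
      rw [map_add, map_smul, hξ, LinearMap.mem_ker.1 hy] at h1
      simpa using h1)
    (fun z ↦ ⟨-η z, LinearMap.mem_ker.2 (by simp [hξ])⟩)
  have he0 : e 0 = ξ := by simp [e]
  have heD : ∀ j, j ≠ 0 → η (e j) = 0 := by
    intro j hj
    obtain ⟨i, rfl⟩ := Fin.exists_succ_eq.2 hj
    simp [e]
  have hek : e k.succ = x := by simp [e, hk, x']
  refine (AlternatingMap.map_basis_ne_zero_iff e _).2 hne ?_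
  rw [MultilinearMap.alternatization_apply]
  refine Finset.sum_eq_zero fun σ _ ↦ ?_
  rw [MultilinearMap.domDomCongr_apply, tensorPow_apply]
  suffices h : η (e (σ 0)) * ∏ i : Fin n, B (e (σ ⟨2 * (i : ℕ) + 1, by omega⟩))
      (e (σ ⟨2 * (i : ℕ) + 2, by omega⟩)) = 0 by rw [h, smul_zero]
  by_cases hσ : σ 0 = 0
  · refine mul_eq_zero_of_right _ ?_
    have hσ0 : ∀ j, j ≠ 0 → η (e (σ j)) = 0 := fun j hj ↦ heD _ fun h ↦
      hj (σ.injective (h.trans hσ.symm))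
    obtain ⟨j, hj⟩ := σ.surjective k.succ
    have hj0 : j.val ≠ 0 := fun h ↦ by
      obtain rfl : j = 0 := Fin.ext h
      exact Fin.succ_ne_zero k (hj.symm.trans hσ)
    rcases Nat.even_or_odd' j.val with ⟨i, hi | hi⟩
    · refine Finset.prod_eq_zero (Finset.mem_univ (⟨i - 1, by omega⟩ : Fin n)) ?_
      have h1 : (⟨2 * (i - 1) + 2, by omega⟩ : Fin (2 * n + 1)) = j := Fin.ext (by simp; omega)
      simp only [h1, hj, hek]
      rw [hB, hdeg _ (hσ0 _ (by simp [Fin.ext_iff])), neg_zero]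
    · refine Finset.prod_eq_zero (Finset.mem_univ (⟨i, by omega⟩ : Fin n)) ?_
      have h1 : (⟨2 * i + 1, by omega⟩ : Fin (2 * n + 1)) = j := Fin.ext (by simp; omega)
      simp only [h1, hj, hek]
      rw [hdeg _ (hσ0 _ (by simp [Fin.ext_iff]))]
  · rw [heD _ hσ, zero_mul]

end Contact

namespace AlmostContactMetricStructure
section Horizontal

open Module

variable {E : Type*} [NormedAddCommGroup E] [NormedSpace ℝ E] [FiniteDimensional ℝ E]
  {H : Type*} [TopologicalSpace H] {I : ModelWithCorners ℝ E H}
  {M : Type*} [TopologicalSpace M] [ChartedSpace H M] [IsManifold I ∞ M]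
  (S : AlmostContactMetricStructure I M) {x : M}

theorem finrank_D {n : ℕ} (hE : finrank ℝ E = n + 1) (x : M) :
    finrank ℝ (S.D x) = n := by
  have : FiniteDimensional ℝ (TangentSpace I x) := inferInstanceAs (FiniteDimensional ℝ E)
  have hE' : finrank ℝ (TangentSpace I x) = n + 1 := hE
  exact finrank_ker_of_apply_eq_one hE' (S.η_ξ x)

/-- The metric on the horizontal space. -/
def horInner (x : M) : S.D x →ₗ[ℝ] S.D x →ₗ[ℝ] ℝ :=
  (ContinuousLinearMap.toBilinForm (S.g.inner x)).compl₁₂ (S.D x).subtype (S.D x).subtype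

/-- The complex structure of the horizontal space. -/
def horφ (x : M) : S.D x →ₗ[ℝ] S.D x :=
  (S.φ x : TangentSpace I x →ₗ[ℝ] TangentSpace I x).restrict fun v _ ↦ S.φ_mem v

/-- The restriction of `A` to the horizontal space. -/
def horA (x : M) : S.D x →ₗ[ℝ] S.D x :=
  (S.A x : TangentSpace I x →ₗ[ℝ] TangentSpace I x).restrict fun v _ ↦ S.A_mem v

/-- For a contact form `η`, the skew part of `A` is nondegenerate on the horizontal space. -/
theorem exists_inner_A_sub_ne_zero {n : ℕ} (hE : finrank ℝ E = 2 * n + 1)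
    (hcontact : IsContactForm n S.η) {u : TangentSpace I x} (hu : u ∈ S.D x) (hu0 : u ≠ 0) :
    ∃ v ∈ S.D x, S.g.inner x v (S.A x u) - S.g.inner x u (S.A x v) ≠ 0 := by
  have : FiniteDimensional ℝ (TangentSpace I x) := inferInstanceAs (FiniteDimensional ℝ E)
  let G : TangentSpace I x →ₗ[ℝ] TangentSpace I x →ₗ[ℝ] ℝ :=
    ContinuousLinearMap.toBilinForm (S.g.inner x)
  let A' : TangentSpace I x →ₗ[ℝ] TangentSpace I x := S.A x
  let B : TangentSpace I x →ₗ[ℝ] TangentSpace I x →ₗ[ℝ] ℝ :=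
    (1 / 2 : ℝ) • (G.comp A' - (G.comp A').flip)
  have hB : ∀ u v, B u v = extDerivOneForm S.η x u v := fun u v ↦ by
    rw [S.extDerivOneForm_η]
    simp [B, G, A']
  obtain ⟨v, hv⟩ := hcontact x
  have hne : MultilinearMap.alternatization
      (tensorPow n (S.η x : TangentSpace I x →ₗ[ℝ] ℝ) B) ≠ 0 := by
    intro h0
    have h1 := congrArg (fun f ↦ f v) h0
    simp only [MultilinearMap.alternatization_apply, MultilinearMap.domDomCongr_apply,
      tensorPow_apply, hB, AlternatingMap.zero_apply] at h1
    refine hv ?_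
    rw [wedgePow]
    convert mul_zero _
    rw [← h1]
    refine Finset.sum_congr rfl fun σ _ ↦ ?_
    simp [Units.smul_def]
  have hE' : finrank ℝ (TangentSpace I x) = 2 * n + 1 := hE
  have hskew : ∀ u v, B v u = -B u v := fun u v ↦ by
    rw [hB, hB, S.extDerivOneForm_η, S.extDerivOneForm_η]
    ring
  obtain ⟨w, hw, hw0⟩ :=
    exists_apply_ne_zero_of_alternatization_ne_zero hE' hskew (S.η_ξ x) hne hu hu0
  refine ⟨w, hw, fun h ↦ hw0 ?_⟩
  rw [hB, S.extDerivOneForm_η, S.g.symm x (S.A x u), S.g.symm x (S.A x w), h, mul_zero]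

/-- Constant horizontal sectional curvature determines the curvature on the horizontal space. -/
theorem inner_curvature_eq_of_sectionalCurvature [Nontrivial E] {c : ℝ}
    (hc : ∀ u ∈ S.D x, ∀ v ∈ S.D x, LinearIndependent ℝ ![u, v] →
      sectionalCurvature S.g x u v = c)
    (u v w z : S.D x) :
    S.g.inner x (curvature (leviCivita S.g) x u v w) (z : TangentSpace I x)
      = c * (S.horInner x v w * S.horInner x u z - S.horInner x u w * S.horInner x v z) := by
  refine curvatureLike_eq_of_sectional (S.horInner x) (fun u v ↦ S.g.symm x u v)
    (S := fun u v w z : S.D x ↦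
      S.g.inner x (curvature (leviCivita S.g) x u v w) (z : TangentSpace I x))
    (fun u v w z z' ↦ by simp) (fun u v w z ↦ inner_curvature_swap S.g _ _ _ _)
    (fun u v w z ↦ inner_curvature_skew S.g _ _ _ _)
    (fun u v w z ↦ inner_curvature_pair_symm S.g _ _ _ _)
    (fun u v w z ↦ inner_curvature_bianchi S.g _ _ _ _) (fun u v ↦ ?_) u v w z
  change S.g.inner x (curvature (leviCivita S.g) x u v v) (u : TangentSpace I x)
    = c * (S.g.inner x u u * S.g.inner x v v - S.g.inner x u v ^ 2)
  by_cases hv : (v : TangentSpace I x) = 0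
  · rw [inner_curvature_skew, hv]
    simp
  by_cases hu : ∃ a : ℝ, a • (v : TangentSpace I x) = u
  · obtain ⟨a, ha⟩ := hu
    have h0 := inner_curvature_skew S.g (u : TangentSpace I x) v v v
    simp only [← ha] at h0 ⊢
    simp only [map_smul, smul_apply, smul_eq_mul]
    linear_combination a / 2 * h0
  push Not at hu
  have hli : LinearIndependent ℝ ![(u : TangentSpace I x), v] :=
    LinearIndependent.pair_symm_iff.1 ((LinearIndependent.pair_iff' hv).2 hu)
  have hne : S.g.inner x v v • (u : TangentSpace I x) - S.g.inner x u v • (v : TangentSpace I x)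
      ≠ 0 := by
    intro h
    have hvv := S.g.pos x v hv
    refine hu ((S.g.inner x v v)⁻¹ * S.g.inner x u v) ?_
    rw [mul_smul, ← sub_eq_zero.1 h, inv_smul_smul₀ hvv.ne']
  have hpos := S.g.pos x _ hne
  have hden : S.g.inner x u u * S.g.inner x v v - S.g.inner x u v ^ 2 ≠ 0 := by
    intro h
    refine hpos.ne' ?_
    simp only [map_sub, map_smul, sub_apply, smul_apply, smul_eq_mul]
    rw [S.g.symm x (v : TangentSpace I x) u]
    linear_combination S.g.inner x v v * h
  rw [← hc u u.2 v v.2 hli, sectionalCurvature, div_mul_cancel₀ _ hden]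

end Horizontal
end AlmostContactMetricStructure

end AlmostContact

end

theorem mainTheorem1 (n : ℕ) (hn : 1 ≤ n)
    {M : Type*} [TopologicalSpace M] [T2Space M] [SecondCountableTopology M]
    [ChartedSpace (EuclideanSpace ℝ (Fin (2 * n + 1))) M] [IsManifold (𝓡 (2 * n + 1)) ∞ M]
    (S : AlmostContact.AlmostContactMetricStructure (𝓡 (2 * n + 1)) M)
    (hcontact : AlmostContact.IsContactForm n S.η)
    (hA : ∀ (x : M), ∀ u ∈ S.D x, S.A x (S.φ x u) + S.φ x (S.A x u) = 0)
    (hφ : ∀ (x : M), ∀ u ∈ S.D x, ∀ v ∈ S.D x, ∀ w ∈ S.D x,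
      S.g.inner x (AlmostContact.nablaEndo (AlmostContact.leviCivita S.g) S.φ x u v) w = 0)
    (p : M) (c : ℝ)
    (hc : ∀ u ∈ S.D p, ∀ v ∈ S.D p, LinearIndependent ℝ ![u, v] →
      AlmostContact.sectionalCurvature S.g p u v = c) :
    2 * n + 1 = 5 ∧ (Set.BijOn (S.A p) (S.D p) (S.D p) ↔ c ≠ 0) := by
  have : FiniteDimensional ℝ (TangentSpace (𝓡 (2 * n + 1)) p) :=
    inferInstanceAs (FiniteDimensional ℝ (EuclideanSpace ℝ (Fin (2 * n + 1))))
  have hE : Module.finrank ℝ (EuclideanSpace ℝ (Fin (2 * n + 1))) = 2 * n + 1 := by simp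
  have : Nontrivial (EuclideanSpace ℝ (Fin (2 * n + 1))) :=
    Module.nontrivial_of_finrank_pos (R := ℝ) (by omega)
  have key := AlmostContact.horizontal_dimension_and_bijective (B := S.horInner p) (J := S.horφ p)
    (A := S.horA p) (c := c) (q := fun z w : S.D p ↦
      S.g.inner p (AlmostContact.nablaEndo (AlmostContact.leviCivita S.g) S.φ p (S.ξ p) z.1) w.1)
    hn (S.finrank_D hE p) (fun u v ↦ S.g.symm p u v)
    (fun u hu ↦ S.g.pos p u fun h ↦ hu (Subtype.ext h))
    (fun u ↦ Subtype.ext (by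
      refine (S.φ_φ p u).trans ?_
      rw [S.mem_D.1 u.2, zero_smul, add_zero]
      rfl))
    (fun u v ↦ S.inner_φ_left _ _)
    (fun u ↦ Subtype.ext (eq_neg_of_add_eq_zero_left (hA p u u.2)))
    (fun u hu ↦ by
      obtain ⟨v, hv, h⟩ := S.exists_inner_A_sub_ne_zero hE hcontact u.2
        fun h ↦ hu (Subtype.ext h)
      exact ⟨⟨v, hv⟩, h⟩)
    (fun u v w z ↦ by
      have h := AlmostContact.AlmostContactMetricStructure.inner_curvature_φ hφ u.2 v.2 w.2 z.2
      have h1 := S.inner_curvature_eq_of_sectionalCurvature hc u v (S.horφ p w) z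
      have h2 := S.inner_curvature_eq_of_sectionalCurvature hc u v w (S.horφ p z)
      have h3 : c * (S.horInner p v (S.horφ p w) * S.horInner p u z
          - S.horInner p u (S.horφ p w) * S.horInner p v z)
          + c * (S.horInner p v w * S.horInner p u (S.horφ p z)
          - S.horInner p u w * S.horInner p v (S.horφ p z)) = _ :=
        (congrArg₂ (· + ·) h1 h2).symm.trans h
      exact Eq.trans (by ring) h3)
  refine ⟨by omega, ?_⟩
  rw [← key.2]
  constructor
  · intro h
    refine ⟨fun u v huv ↦ Subtype.ext (h.injOn u.2 v.2 (congrArg Subtype.val huv)), fun v ↦ ?_⟩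
    obtain ⟨u, hu, huv⟩ := h.surjOn v.2
    exact ⟨⟨u, hu⟩, Subtype.ext huv⟩
  · intro h
    refine ⟨fun v _ ↦ S.A_mem v, fun u hu v hv huv ↦ ?_, fun v hv ↦ ?_⟩
    · exact congrArg Subtype.val (h.1 (a₁ := ⟨u, hu⟩) (a₂ := ⟨v, hv⟩) (Subtype.ext huv))
    · obtain ⟨u, hu⟩ := h.2 ⟨v, hv⟩
      exact ⟨u, u.2, congrArg Subtype.val hu⟩
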